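/- Notation. $M_n$ is the space of complex $n\times n$ matrices, and for $T\in \mathrm{GL}(n,\mathbb{C})$ we write $\mathrm{Ad}_T A:=TAT^{-1}$. A map $\phi:\mathrm{SU}(n)\to M_n$ is *spectrum-preserving* if $X$ and $\phi(X)$ have the same set of eigenvalues for every $X$, *commutativity-preserving* if $\phi(X)\phi(Y)=\phi(Y)\phi(X)$ whenever $XY=YX$, and *CS-preserving* if it is both. For $X\in \mathrm{SU}(n)$ there are unique real numbers $$x_1\le x_2\le\cdots\le x_n\le x_1+1,\qquad \sum_{j} x_j=0,$$ such that $\exp(2\pi i x_1),\dots,\exp(2\pi i x_n)$ are the eigenvalues of $X$ counted with multiplicity; put $\lambda_j(X):=\exp(2\pi i x_j)$. A *maximal torus* of $\mathrm{SU}(n)$ is a subgroup which is isomorphic, as a topological group, to a finite power of the circle group, and which is maximal among such subgroups. We say that $\phi$ *reorders* on a maximal torus $\mathbb{T}$ if there is $T\in\mathrm{GL}(n,\mathbb{C})$ with $$\phi(X)=\mathrm{Ad}_T\,\mathrm{diag}(\lambda_1(X),\dots,\lambda_n(X))\qquad\text{for all } X\in\mathbb{T}.$$ **Proposition.** (1)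 Let $n\ge 3$ and let $\phi:\mathrm{SU}(n)\to M_n$ be continuous and CS-preserving. If $\phi$ reorders on at least one maximal torus of $\mathrm{SU}(n)$, then there is $T\in\mathrm{GL}(n,\mathbb{C})$ such that $$\phi(X)=\mathrm{Ad}_T\,\mathrm{diag}(\lambda_1(X),\dots,\lambda_n(X))\qquad\text{for all } X\in\mathrm{SU}(n).$$ (2) This fails for $n=2$: maximal tori of $\mathrm{SU}(2)$ exist, and there is a continuous CS-preserving map $\phi:\mathrm{SU}(2)\to M_2$ which reorders on every maximal torus of $\mathrm{SU}(2)$, but for which no $T\in\mathrm{GL}(2,\mathbb{C})$ satisfies $\phi(X)=\mathrm{Ad}_T\,\mathrm{diag}(\lambda_1(X),\lambda_2(X))$ for all $X\in\mathrm{SU}(2)$. -/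

import Mathlib

/-- The special unitary group `SU(n)`, with the topology it inherits from `M_n(ℂ)`. -/
abbrev SU (n : ℕ) : Type := Matrix.specialUnitaryGroup (Fin n) ℂ

/-- The matrix space `M_n = M_n(ℂ)`, with its usual topology. -/
abbrev Mat (n : ℕ) : Type := Matrix (Fin n) (Fin n) ℂ

/-- The conjugation `Ad_T : A ↦ T A T⁻¹` by an invertible matrix `T`. -/
def conjBy {n : ℕ} (T : GL (Fin n) ℂ) (A : Mat n) : Mat n :=
  (T : Mat n) * A * ((T⁻¹ : GL (Fin n) ℂ) : Mat n)

/-- `φ : SU(n) → M_n` preserves commutativity. -/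
def CommutativityPreserving {n : ℕ} (φ : SU n → Mat n) : Prop :=
  ∀ X Y : SU n, X * Y = Y * X → φ X * φ Y = φ Y * φ X

/-- `φ : SU(n) → M_n` preserves spectra (as sets). -/
def SpectrumPreserving {n : ℕ} (φ : SU n → Mat n) : Prop :=
  ∀ X : SU n, spectrum ℂ (φ X) = spectrum ℂ (X : Mat n)

/-- A subgroup of a topological group is a torus if it is isomorphic, as a topological group, to a
finite power of the circle group. -/
def IsTorus {G : Type*} [Group G] [TopologicalSpace G] (H : Subgroup G) : Prop :=
  ∃ k : ℕ, Nonempty (H ≃ₜ* (Fin k → Circle))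

/-- A maximal torus: a torus that is not properly contained in another torus. -/
def IsMaximalTorus {G : Type*} [Group G] [TopologicalSpace G] (H : Subgroup G) : Prop :=
  Maximal IsTorus H

/-- `x` is a tuple of normalized spectral angles of `X`: it is non-decreasing, all of its entries
lie within distance one of each other (for a non-decreasing tuple, this is `x_n ≤ x_1 + 1`), its sum
is zero, and the numbers `exp(2πi x_j)` are the eigenvalues of `X`, counted with their algebraic
multiplicities. -/
structure IsSpectralAngles {n : ℕ} (X : Mat n) (x : Fin n → ℝ) : Prop where
  mono : Monotone x
  width : ∀ i j, x j ≤ x i + 1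
  sum_eq_zero : ∑ j, x j = 0
  spec : X.charpoly.roots =
    Finset.univ.val.map (fun j => Complex.exp (2 * Real.pi * Complex.I * (x j : ℂ)))

theorem map_univ_val_eq_iff {α : Type*} {n : ℕ} (f g : Fin n → α) :
    Finset.univ.val.map f = Finset.univ.val.map g ↔ ∃ σ : Equiv.Perm (Fin n), f = g ∘ σ := by
  classical
  constructor
  · intro h
    have hc : ∀ c : α, Nonempty ({a // f a = c} ≃ {b // g b = c}) := by
      intro c
      refine ⟨Fintype.equivOfCardEq ?_⟩
      have h1 := congrArg (Multiset.count c) h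
      rw [Multiset.count_map, Multiset.count_map] at h1
      rw [Fintype.card_subtype, Fintype.card_subtype]
      simp only [eq_comm (a := c)] at h1
      exact h1
    refine ⟨Equiv.ofFiberEquiv fun c => (hc c).some, ?_⟩
    ext a
    exact (Equiv.ofFiberEquiv_map (fun c => (hc c).some) a).symm
  · rintro ⟨σ, rfl⟩
    rw [← Multiset.map_map, Multiset.map_univ_val_equiv]

theorem exists_tuple_of_card {α : Type*} {n : ℕ} (s : Multiset α) (hs : s.card = n) :
    ∃ z : Fin n → α, s = Finset.univ.val.map z := by
  subst hs
  refine ⟨fun i => s.toList.get (i.cast (by simp)), ?_⟩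
  rw [Fin.univ_val_map]
  conv_lhs => rw [← Multiset.coe_toList s]
  congr 1
  apply List.ext_get <;> simp

theorem exists_angle {z : ℂ} (hz : ‖z‖ = 1) :
    ∃ y : ℝ, 0 ≤ y ∧ y < 1 ∧ Complex.exp (2 * Real.pi * Complex.I * (y : ℂ)) = z := by
  refine ⟨Int.fract (z.arg / (2 * Real.pi)), Int.fract_nonneg _, Int.fract_lt_one _, ?_⟩
  have hpi : (Real.pi : ℂ) ≠ 0 := by exact_mod_cast Real.pi_ne_zero
  rw [← Int.self_sub_floor]
  have h1 : 2 * Real.pi * Complex.I *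
      ((z.arg / (2 * Real.pi) - ⌊z.arg / (2 * Real.pi)⌋ : ℝ) : ℂ)
      = z.arg * Complex.I - ⌊z.arg / (2 * Real.pi)⌋ * (2 * Real.pi * Complex.I) := by
    push_cast
    field_simp
  rw [h1, Complex.exp_sub, Complex.exp_int_mul_two_pi_mul_I, div_one]
  have := Complex.norm_mul_exp_arg_mul_I z
  rwa [hz, Complex.ofReal_one, one_mul] at this

theorem exists_normalized_angles {n : ℕ} (z : Fin n → ℂ) (hz : ∀ i, ‖z i‖ = 1)
    (hp : ∏ i, z i = 1) :
    ∃ x : Fin n → ℝ, Monotone x ∧ (∀ i j, x j ≤ x i + 1) ∧ ∑ j, x j = 0 ∧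
      Finset.univ.val.map z =
        Finset.univ.val.map (fun j => Complex.exp (2 * Real.pi * Complex.I * (x j : ℂ))) := by
  have hpi : (Real.pi : ℂ) ≠ 0 := by exact_mod_cast Real.pi_ne_zero
  choose y hy0 hy1 hyz using fun i => exists_angle (hz i)
  obtain ⟨m, hm⟩ : ∃ m : ℤ, ∑ i, y i = m := by
    have h : Complex.exp (2 * Real.pi * Complex.I * ((∑ i, y i : ℝ) : ℂ)) = 1 := by
      push_cast
      rw [Finset.mul_sum, Complex.exp_sum, ← hp]
      exact Finset.prod_congr rfl fun i _ => hyz i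
    obtain ⟨m, hm⟩ := Complex.exp_eq_one_iff.1 h
    refine ⟨m, ?_⟩
    have h2 : ((∑ i, y i : ℝ) : ℂ) = (m : ℂ) := by
      have h3 : (2 * Real.pi * Complex.I : ℂ) ≠ 0 := by simp [hpi]
      apply mul_left_cancel₀ h3
      rw [hm]; ring
    exact_mod_cast h2
  have hm0 : 0 ≤ m := by
    have : (0 : ℝ) ≤ m := hm ▸ Finset.sum_nonneg fun i _ => hy0 i
    exact_mod_cast this
  have hmn : m ≤ n := by
    have : (m : ℝ) ≤ n := by
      rw [← hm]
      calc ∑ i, y i ≤ ∑ _i : Fin n, (1 : ℝ) := Finset.sum_le_sum fun i _ => (hy1 i).le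
        _ = n := by simp
    exact_mod_cast this
  lift m to ℕ using hm0
  have hmn' : m ≤ n := by exact_mod_cast hmn
  set σ := Tuple.sort y with hσ
  have hmono : Monotone (y ∘ σ) := Tuple.monotone_sort y
  let w : Fin n → ℝ := fun j => if n - m ≤ (j : ℕ) then y (σ j) - 1 else y (σ j)
  have hw : ∀ i j, w j ≤ w i + 1 := by
    intro i j
    have a1 := hy0 (σ i)
    have a2 := hy1 (σ i)
    have a3 := hy0 (σ j)
    have a4 := hy1 (σ j)
    by_cases hi : n - m ≤ (i : ℕ) <;> by_cases hj : n - m ≤ (j : ℕ) <;>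
      simp only [w, hi, hj, if_true, if_false] <;> try linarith
    have : y (σ j) ≤ y (σ i) := hmono (show j ≤ i from Fin.le_def.2 (by omega))
    linarith
  have hcard : (Finset.univ.filter fun j : Fin n => n - m ≤ (j : ℕ)).card = m := by
    have h1 := Fin.card_filter_val_lt (n := n) (m := n - m)
    have h2 := Finset.card_filter_add_card_filter_not (s := (Finset.univ : Finset (Fin n)))
      (fun j : Fin n => (j : ℕ) < n - m)
    simp only [not_lt, Finset.card_univ, Fintype.card_fin] at h2
    omega
  have hsum : ∑ j, w j = 0 := by
    have h1 : ∀ j, w j = y (σ j) - if n - m ≤ (j : ℕ) then 1 else 0 := by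
      intro j; simp only [w]; split_ifs <;> simp
    simp only [h1, Finset.sum_sub_distrib, Finset.sum_boole]
    rw [hcard, Equiv.sum_comp σ y, hm]; simp
  have hexp : ∀ j, Complex.exp (2 * Real.pi * Complex.I * (w j : ℂ)) = z (σ j) := by
    intro j
    rw [← hyz (σ j)]
    simp only [w]
    split_ifs
    · push_cast
      rw [mul_sub, Complex.exp_sub, mul_one, Complex.exp_two_pi_mul_I, div_one]
    · rfl
  refine ⟨w ∘ Tuple.sort w, Tuple.monotone_sort w, fun i j => hw _ _, ?_, ?_⟩
  · rw [← hsum]; exact Equiv.sum_comp (Tuple.sort w) w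
  · simp only [Function.comp_apply, hexp]
    rw [map_univ_val_eq_iff]
    exact ⟨(σ.symm.trans (Tuple.sort w).symm), by ext j; simp⟩

theorem normalized_angles_unique {n : ℕ} {x x' : Fin n → ℝ}
    (hx : Monotone x) (hx' : Monotone x') (hw : ∀ i j, x j ≤ x i + 1)
    (hw' : ∀ i j, x' j ≤ x' i + 1) (hs : ∑ j, x j = 0) (hs' : ∑ j, x' j = 0)
    (h : Finset.univ.val.map (fun j => Complex.exp (2 * Real.pi * Complex.I * (x j : ℂ))) =
      Finset.univ.val.map (fun j => Complex.exp (2 * Real.pi * Complex.I * (x' j : ℂ)))) :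
    x = x' := by
  have hpi : (Real.pi : ℂ) ≠ 0 := by exact_mod_cast Real.pi_ne_zero
  obtain ⟨σ, hσ⟩ := (map_univ_val_eq_iff _ _).1 h
  have hk : ∀ j, ∃ k : ℤ, x j = x' (σ j) + k := by
    intro j
    have h1 := congrFun hσ j
    simp only [Function.comp_apply] at h1
    obtain ⟨k, hk⟩ := Complex.exp_eq_exp_iff_exists_int.1 h1
    refine ⟨k, ?_⟩
    have h3 : (2 * Real.pi * Complex.I : ℂ) ≠ 0 := by simp [hpi]
    have : (x j : ℂ) = x' (σ j) + k := by
      apply mul_left_cancel₀ h3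
      rw [hk]; ring
    exact_mod_cast this
  choose k hk using hk
  have hksum : ∑ j, k j = 0 := by
    have : ∑ j, (k j : ℝ) = 0 := by
      have h1 : ∑ j, x j = ∑ j, x' (σ j) + ∑ j, (k j : ℝ) := by
        rw [← Finset.sum_add_distrib]; exact Finset.sum_congr rfl fun j _ => hk j
      rw [Equiv.sum_comp σ x', hs, hs'] at h1
      linarith
    exact_mod_cast this
  -- a positive and a negative integer shift force all the entries involved
  have key : ∀ i j, 0 < k i → k j < 0 →
      k i = 1 ∧ k j = -1 ∧ x i = x j + 1 := by
    intro i j hi hj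
    have b1 := hw j i
    have b2 := hw' (σ i) (σ j)
    have e1 := hk i
    have e2 := hk j
    have hle : k i - k j ≤ 2 := by
      have : ((k i - k j : ℤ) : ℝ) ≤ 2 := by push_cast; linarith
      exact_mod_cast this
    have hi1 : k i = 1 := by omega
    have hj1 : k j = -1 := by omega
    refine ⟨hi1, hj1, ?_⟩
    rw [hi1] at e1; rw [hj1] at e2
    push_cast at e1 e2
    linarith
  have hperm : ∃ τ : Equiv.Perm (Fin n), x = (x' ∘ σ) ∘ τ := by
    rw [← map_univ_val_eq_iff]
    by_cases hz : ∀ j, k j = 0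
    · congr 1; ext j; simp [hk j, hz j]
    · push Not at hz
      obtain ⟨p, hp⟩ : ∃ p, 0 < k p := by
        by_contra! hc
        obtain ⟨j, hj⟩ := hz
        exact hj ((Finset.sum_eq_zero_iff_of_nonpos fun i _ => hc i).1 hksum j (Finset.mem_univ j))
      obtain ⟨q, hq⟩ : ∃ q, k q < 0 := by
        by_contra! hc
        obtain ⟨j, hj⟩ := hz
        exact hj ((Finset.sum_eq_zero_iff_of_nonneg fun i _ => hc i).1 hksum j (Finset.mem_univ j))
      have hpq := (key p q hp hq).2.2
      have hstep : ∀ (f : ℝ → ℤ) (j : Fin n),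
          f (x j) - f (x' (σ j)) = k j * (f (x p) - f (x q)) := by
        intro f j
        have e := hk j
        rcases lt_trichotomy (k j) 0 with hj | hj | hj
        · obtain ⟨-, b, c⟩ := key p j hp hj
          rw [b] at e ⊢
          push_cast at e
          have e1 : x j = x q := by linarith
          have e2 : x' (σ j) = x p := by linarith
          rw [e1, e2]; ring
        · rw [hj] at e ⊢
          push_cast at e
          rw [e]; simp
        · obtain ⟨b, -, c⟩ := key j q hj hq
          rw [b] at e ⊢
          push_cast at e
          have e1 : x j = x p := by linarith
          have e2 : x' (σ j) = x q := by linarith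
          rw [e1, e2]; ring
      ext c
      have hc : ∑ j, ((if c = x j then 1 else 0 : ℤ) - if c = x' (σ j) then 1 else 0) = 0 := by
        rw [Finset.sum_congr rfl fun j _ => hstep (fun t => if c = t then 1 else 0) j,
          ← Finset.sum_mul, hksum, zero_mul]
      rw [Finset.sum_sub_distrib, Finset.sum_boole, Finset.sum_boole, sub_eq_zero] at hc
      rw [Multiset.count_map, Multiset.count_map]
      exact_mod_cast hc
  obtain ⟨τ, hτ⟩ := hperm
  have h1 : x = x' ∘ (τ.trans σ) := by rw [hτ]; rfl
  have h2 := Tuple.unique_monotone (f := x') (σ := τ.trans σ) (τ := 1)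
    (h1 ▸ hx) (by simpa using hx')
  rw [h1, h2]; rfl

open scoped Matrix.Norms.L2Operator in
theorem norm_eigenvalue_eq_one {n : ℕ} (X : SU n) {z : ℂ} (hz : z ∈ (X : Mat n).charpoly.roots) :
    ‖z‖ = 1 := by
  have hroot : z ∈ spectrum ℂ (X : Mat n) :=
    Matrix.mem_spectrum_iff_isRoot_charpoly.2 (Polynomial.isRoot_of_mem_roots hz)
  exact spectrum.norm_eq_one_of_unitary
    (Matrix.specialUnitaryGroup_le_unitaryGroup X.2) hroot

/-- Every special unitary matrix has exactly one tuple of normalized spectral angles. -/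
theorem existsUnique_spectralAngles {n : ℕ} (X : SU n) :
    ∃! x : Fin n → ℝ, IsSpectralAngles (X : Mat n) x := by
  have hcard : (X : Mat n).charpoly.roots.card = n := by
    rw [IsAlgClosed.card_roots_eq_natDegree, Matrix.charpoly_natDegree_eq_dim, Fintype.card_fin]
  obtain ⟨z, hz⟩ := exists_tuple_of_card _ hcard
  obtain ⟨x, h1, h2, h3, h4⟩ := exists_normalized_angles z
    (fun i => norm_eigenvalue_eq_one X (by rw [hz]; simp))
    (by
      have hd := Matrix.det_eq_prod_roots_charpoly (X : Mat n)
      rw [(Matrix.mem_specialUnitaryGroup_iff.1 X.2).2, hz] at hd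
      exact hd.symm)
  refine ⟨x, ⟨h1, h2, h3, hz.trans h4⟩, fun x' hx' => ?_⟩
  exact normalized_angles_unique hx'.mono h1 hx'.width h2 hx'.sum_eq_zero h3
    (hx'.spec.symm.trans (hz.trans h4))

/-- The unique `x_1 ≤ ⋯ ≤ x_n ≤ x_1 + 1` with sum zero for which the `exp(2πi x_j)` constitute the
spectrum of `X ∈ SU(n)`. -/
noncomputable def spectralAngles {n : ℕ} (X : SU n) : Fin n → ℝ :=
  (existsUnique_spectralAngles X).choose

theorem spectralAngles_spec {n : ℕ} (X : SU n) :
    IsSpectralAngles (X : Mat n) (spectralAngles X) :=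
  (existsUnique_spectralAngles X).choose_spec.1

/-- The spectral selection `λ_j(X) = exp(2πi x_j)`. -/
noncomputable def spectralSelection {n : ℕ} (X : SU n) (j : Fin n) : ℂ :=
  Complex.exp (2 * Real.pi * Complex.I * (spectralAngles X j : ℂ))

/-- `φ` is a reordering on the subgroup `H` (used for a maximal torus `H`): its restriction to `H`
is of the form `X ↦ Ad_T diag(λ_1(X), …, λ_n(X))` for one invertible matrix `T`. -/
def ReordersOn {n : ℕ} (φ : SU n → Mat n) (H : Subgroup (SU n)) : Prop :=
  ∃ T : GL (Fin n) ℂ, ∀ X ∈ H, φ X = conjBy T (Matrix.diagonal (spectralSelection X))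

/-- `φ` is globally of spectral-selection type: it has the form `X ↦ Ad_T diag(λ_1(X), …, λ_n(X))` on
all of `SU(n)`, for one invertible matrix `T`. -/
def IsSelectionType {n : ℕ} (φ : SU n → Mat n) : Prop :=
  ∃ T : GL (Fin n) ℂ, ∀ X : SU n, φ X = conjBy T (Matrix.diagonal (spectralSelection X))

/-! For `n ≥ 3`, replace `φ` by its conjugate `ψ` under `T⁻¹`, so that no conjugation is left on the
given torus. That torus contains `g * t * g⁻¹` for a fixed `g` and every diagonal `t`. Let `S` be
the closed set of all `h` with `ψ (h * t * h⁻¹) = diag(λ(t))` for every diagonal `t`; then `g ∈ S`.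

The set `S` is stable under right multiplication by plane rotations `k`
(`reorders_mul_planeRotation`). A diagonal `r` with equal entries at the two rotated coordinates
commutes with `k`, so `g * r * g⁻¹` commutes with the `gk`-conjugate of `t`. Since `n ≥ 3`, such an
`r` can separate any two positions of the selection, which forces `ψ` to be diagonal at that
conjugate. The diagonal entries lie in the finite spectrum of `t` and vary continuously with the
rotation angle, so they keep their value at angle zero.

It remains to see that conjugates of the diagonal torus by elements of `S` cover the group. Instead
of generating the group by rotations, Jacobi's method is run inside the compact set `S`: a maximizer
of a linear functional diagonalizes a Hermitian matrix with simple spectrum and the same eigenbasis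
as a given `X`, hence diagonalizes `X`.

For `n = 2` the separating `r` does not exist. The counterexample is upper triangular with diagonal
`λ(X)` and corner `|X₀₁|`. On a commutative subgroup the corner is a constant multiple of `λ₂ - λ₁`,
so one unipotent conjugation removes it, but the constant depends on the subgroup. -/

/-! ### Compactness of the group and conjugation invariance of the selection. -/

theorem isClosed_specialUnitaryGroup (n : ℕ) :
    IsClosed ((Matrix.specialUnitaryGroup (Fin n) ℂ : Submonoid (Mat n)) : Set (Mat n)) := by
  have : ((Matrix.specialUnitaryGroup (Fin n) ℂ : Submonoid (Mat n)) : Set (Mat n))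
      = {A : Mat n | A * star A = 1} ∩ {A : Mat n | A.det = 1} := by
    ext A
    simp [Matrix.mem_specialUnitaryGroup_iff, Matrix.mem_unitaryGroup_iff]
  rw [this]
  refine IsClosed.inter (isClosed_eq ?_ continuous_const) (isClosed_eq ?_ continuous_const)
  · exact continuous_id.matrix_mul continuous_id.matrix_conjTranspose
  · exact continuous_id.matrix_det

instance compactSpace_SU (n : ℕ) : CompactSpace (SU n) := by
  refine isCompact_iff_compactSpace.1 (IsCompact.of_isClosed_subset
    (s := Set.univ.pi fun _ : Fin n => Set.univ.pi fun _ : Fin n => Metric.closedBall (0 : ℂ) 1)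
    (isCompact_univ_pi fun _ => isCompact_univ_pi fun _ => isCompact_closedBall _ _)
    (isClosed_specialUnitaryGroup n) ?_)
  intro A hA i _ j _
  simpa using entry_norm_bound_of_unitary (Matrix.specialUnitaryGroup_le_unitaryGroup hA) i j

theorem SU.continuous_inv (n : ℕ) : Continuous fun X : SU n => X⁻¹ :=
  Continuous.subtype_mk (continuous_subtype_val.matrix_conjTranspose) _

theorem SU.mul_star_self {n : ℕ} (X : SU n) : (X : Mat n) * star (X : Mat n) = 1 :=
  Matrix.mem_unitaryGroup_iff.1 (Matrix.specialUnitaryGroup_le_unitaryGroup X.2)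

theorem SU.star_mul_self {n : ℕ} (X : SU n) : star (X : Mat n) * (X : Mat n) = 1 :=
  Matrix.mem_unitaryGroup_iff'.1 (Matrix.specialUnitaryGroup_le_unitaryGroup X.2)

theorem charpoly_conj {n : ℕ} (g X : SU n) :
    ((g * X * g⁻¹ : SU n) : Mat n).charpoly = (X : Mat n).charpoly := by
  have h : ((g * X * g⁻¹ : SU n) : Mat n) = (g : Mat n) * (X : Mat n) * star (g : Mat n) := rfl
  rw [h, mul_assoc, Matrix.charpoly_mul_comm, mul_assoc, SU.star_mul_self, mul_one]

theorem spectralAngles_eq {n : ℕ} {X : SU n} {x : Fin n → ℝ}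
    (h : IsSpectralAngles (X : Mat n) x) : spectralAngles X = x :=
  (existsUnique_spectralAngles X).unique (spectralAngles_spec X) h

theorem spectralSelection_eq_of_charpoly {n : ℕ} {X Y : SU n}
    (h : (X : Mat n).charpoly = (Y : Mat n).charpoly) :
    spectralSelection X = spectralSelection Y := by
  have : spectralAngles X = spectralAngles Y := by
    refine spectralAngles_eq ?_
    have hY := spectralAngles_spec Y
    exact ⟨hY.mono, hY.width, hY.sum_eq_zero, h ▸ hY.spec⟩
  ext j
  simp [spectralSelection, this]

theorem spectralSelection_conj {n : ℕ} (g X : SU n) :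
    spectralSelection (g * X * g⁻¹) = spectralSelection X :=
  spectralSelection_eq_of_charpoly (charpoly_conj g X)

/-! ### The diagonal torus and test elements with prescribed angles. -/

/-- The group of diagonal special unitary matrices. -/
def diagSubgroup (n : ℕ) : Subgroup (SU n) where
  carrier := {X | (X : Mat n).IsDiag}
  one_mem' := Matrix.isDiag_one
  mul_mem' {X Y} hX hY := by
    have hX' : (X : Mat n).IsDiag := hX
    have hY' : (Y : Mat n).IsDiag := hY
    change ((X : Mat n) * (Y : Mat n)).IsDiag
    rw [← hX'.diagonal_diag, ← hY'.diagonal_diag, Matrix.diagonal_mul_diagonal]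
    exact Matrix.isDiag_diagonal _
  inv_mem' {X} hX := Matrix.IsDiag.conjTranspose hX

theorem mem_diagSubgroup {n : ℕ} {X : SU n} : X ∈ diagSubgroup n ↔ (X : Mat n).IsDiag := Iff.rfl

/-- The diagonal special unitary matrix with given diagonal entries. -/
def diagSU {n : ℕ} (z : Fin n → Circle) (hz : ∏ i, z i = 1) : SU n :=
  ⟨Matrix.diagonal fun i => (z i : ℂ), by
    rw [Matrix.mem_specialUnitaryGroup_iff, Matrix.mem_unitaryGroup_iff]
    constructor
    · rw [Matrix.star_eq_conjTranspose, Matrix.diagonal_conjTranspose,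
        Matrix.diagonal_mul_diagonal, ← Matrix.diagonal_one]
      congr 1
      ext i
      simp [Complex.mul_conj]
    · rw [Matrix.det_diagonal]
      exact (map_prod Circle.coeHom z Finset.univ).symm.trans (congrArg Circle.coeHom hz)⟩

theorem diagSU_mem {n : ℕ} (z : Fin n → Circle) (hz : ∏ i, z i = 1) :
    diagSU z hz ∈ diagSubgroup n := Matrix.isDiag_diagonal _

theorem norm_apply_self_of_mem_diagSubgroup {n : ℕ} {X : SU n} (hX : X ∈ diagSubgroup n)
    (i : Fin n) : ‖(X : Mat n) i i‖ = 1 := by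
  have h := congrFun (congrFun (SU.mul_star_self X) i) i
  rw [← Matrix.IsDiag.diagonal_diag hX] at h
  rw [Matrix.star_eq_conjTranspose, Matrix.diagonal_conjTranspose,
        Matrix.diagonal_mul_diagonal] at h
  simp only [Matrix.diagonal_apply_eq, Matrix.diag_apply, Pi.star_apply, Matrix.one_apply_eq,
    RCLike.star_def, Complex.mul_conj] at h
  rw [← Complex.sq_norm] at h
  have h2 : ‖(X : Mat n) i i‖ ^ 2 = 1 := by exact_mod_cast h
  exact (pow_eq_one_iff_of_nonneg (norm_nonneg _) two_ne_zero).1 h2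

theorem exists_eq_diagSU {n : ℕ} {X : SU n} (hX : X ∈ diagSubgroup n) :
    ∃ (z : Fin n → Circle) (hz : ∏ i, z i = 1), X = diagSU z hz := by
  refine ⟨fun i => ⟨(X : Mat n) i i, mem_sphere_zero_iff_norm.2
    (norm_apply_self_of_mem_diagSubgroup hX i)⟩, ?_, ?_⟩
  · apply Circle.coe_injective
    have h := (Matrix.mem_specialUnitaryGroup_iff.1 X.2).2
    rw [← Matrix.IsDiag.diagonal_diag hX, Matrix.det_diagonal] at h
    have h2 := map_prod Circle.coeHom (fun i => (⟨(X : Mat n) i i, mem_sphere_zero_iff_norm.2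
      (norm_apply_self_of_mem_diagSubgroup hX i)⟩ : Circle)) Finset.univ
    exact h2.trans h
  · apply Subtype.ext
    exact (Matrix.IsDiag.diagonal_diag hX).symm

theorem spectralAngles_diagSU {n : ℕ} {x : Fin n → ℝ} (hm : Monotone x)
    (hw : ∀ i j, x j ≤ x i + 1) (hs : ∑ j, x j = 0) (σ : Equiv.Perm (Fin n))
    {z : Fin n → Circle} (hz : ∏ i, z i = 1)
    (h : ∀ i, (z i : ℂ) = Complex.exp (2 * Real.pi * Complex.I * (x (σ i) : ℂ))) :
    spectralAngles (diagSU z hz) = x := by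
  refine spectralAngles_eq ⟨hm, hw, hs, ?_⟩
  have : ((diagSU z hz : SU n) : Mat n) = Matrix.diagonal fun i => (z i : ℂ) := rfl
  rw [this, Matrix.charpoly_diagonal]
  have h1 := Polynomial.roots_multiset_prod_X_sub_C (Finset.univ.val.map fun i => (z i : ℂ))
  rw [Multiset.map_map] at h1
  refine h1.trans ?_
  rw [map_univ_val_eq_iff]
  exact ⟨σ, funext h⟩

/-- The angles fix the selection, while `σ` freely decides where each eigenvalue sits on the
diagonal; this independence is what makes separating elements possible. The zero sum gives
determinant one. -/
theorem exists_diagSU_of_angles {n : ℕ} {x : Fin n → ℝ} (hm : Monotone x)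
    (hw : ∀ i j, x j ≤ x i + 1) (hs : ∑ j, x j = 0) (σ : Equiv.Perm (Fin n)) :
    ∃ r ∈ diagSubgroup n, spectralAngles r = x ∧
      ∀ i, (r : Mat n) i i = Complex.exp (2 * Real.pi * Complex.I * (x (σ i) : ℂ)) := by
  have hz : ∏ i, Circle.exp (2 * Real.pi * x (σ i)) = 1 := by
    have : ∑ i, 2 * Real.pi * x (σ i) = 0 := by
      rw [← Finset.mul_sum, Equiv.sum_comp σ x, hs, mul_zero]
    have h2 := map_sum Circle.expHom (fun i => 2 * Real.pi * x (σ i)) Finset.univ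
    rw [this, map_zero] at h2
    apply Additive.ofMul.injective
    rw [ofMul_prod]
    exact h2.symm
  have he : ∀ i, ((Circle.exp (2 * Real.pi * x (σ i)) : Circle) : ℂ)
      = Complex.exp (2 * Real.pi * Complex.I * (x (σ i) : ℂ)) := by
    intro i
    rw [Circle.coe_exp]
    push_cast
    ring_nf
  refine ⟨diagSU _ hz, diagSU_mem _ hz, spectralAngles_diagSU hm hw hs σ hz he, fun i => ?_⟩
  rw [← he]
  exact Matrix.diagonal_apply_eq _ _

/-- Two coordinates can be made equal while two prescribed positions of the spectral selection stay
apart. -/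
theorem exists_mem_diagSubgroup_separating {n : ℕ} (hn : 3 ≤ n) {a b : Fin n} (hab : a ≠ b)
    {i j : Fin n} (hij : i < j) :
    ∃ r ∈ diagSubgroup n, (r : Mat n) a a = (r : Mat n) b b ∧
      spectralSelection r i ≠ spectralSelection r j := by
  have hn0 : (0 : ℝ) < n := by exact_mod_cast (by omega : 0 < n)
  have hjn : ((j : ℕ) : ℝ) < n := by exact_mod_cast j.2
  have hj0 : (0 : ℝ) ≤ ((j : ℕ) : ℝ) := by positivity
  -- The angles are to be `-u` on the `j` positions before `j` and `v` on the remaining `n - j`. The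
  -- weights make the sum vanish, and `u + v = 1/2` makes the two eigenvalues opposite.
  set u : ℝ := (n - (j : ℕ)) / (2 * n) with hu
  set v : ℝ := (j : ℕ) / (2 * n) with hv
  have huv : u + v = 1 / 2 := by rw [hu, hv]; field_simp; ring
  have hu0 : 0 ≤ u := by apply div_nonneg <;> linarith
  have hv0 : 0 ≤ v := by positivity
  let x : Fin n → ℝ := fun l => if l < j then -u else v
  have hm : Monotone x := by
    intro p q hpq
    simp only [x]
    split_ifs with h1 h2 h2
    · rfl
    · linarith
    · exact absurd (lt_of_le_of_lt hpq h2) h1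
    · rfl
  have hw : ∀ p q, x q ≤ x p + 1 := by
    intro p q
    simp only [x]
    split_ifs <;> linarith
  have hs : ∑ l, x l = 0 := by
    have hc : (Finset.univ.filter fun l : Fin n => l < j).card = (j : ℕ) := by
      rw [← Fin.card_Iio j]
      congr 1
      ext l
      simp
    have hc' := Finset.card_filter_add_card_filter_not (s := (Finset.univ : Finset (Fin n)))
      (fun l : Fin n => l < j)
    rw [hc, Finset.card_univ, Fintype.card_fin] at hc'
    have hc'' : ((Finset.univ.filter fun l : Fin n => ¬ l < j).card : ℝ) = n - (j : ℕ) := by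
      have := congrArg (Nat.cast : ℕ → ℝ) hc'
      push_cast at this
      linarith
    simp only [x]
    rw [Finset.sum_ite, Finset.sum_const, Finset.sum_const, nsmul_eq_mul, nsmul_eq_mul, hc, hc'',
      hu, hv]
    field_simp
    ring
  -- Two values on at least three positions: one value repeats.
  obtain ⟨p, q, hpq, hxpq⟩ : ∃ p q : Fin n, p ≠ q ∧ x p = x q := by
    by_cases h2 : 2 ≤ (j : ℕ)
    · refine ⟨⟨0, by omega⟩, ⟨1, by omega⟩, by simp, ?_⟩
      simp only [x]
      rw [if_pos (Fin.lt_def.2 (by simp; omega)), if_pos (Fin.lt_def.2 (by simp; omega))]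
    · refine ⟨⟨1, by omega⟩, ⟨2, by omega⟩, by simp, ?_⟩
      simp only [x]
      rw [if_neg (not_lt.2 (Fin.le_def.2 (by simp; omega))),
        if_neg (not_lt.2 (Fin.le_def.2 (by simp; omega)))]
  obtain ⟨σ, hσa, hσb⟩ : ∃ σ : Equiv.Perm (Fin n), σ a = p ∧ σ b = q := by
    have h1 : Equiv.swap a p b ≠ p := fun h => hab (by
      have := congrArg (Equiv.swap a p) h
      simp at this
      exact this.symm)
    refine ⟨(Equiv.swap a p).trans (Equiv.swap (Equiv.swap a p b) q), ?_, ?_⟩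
    · simp only [Equiv.trans_apply, Equiv.swap_apply_left]
      exact Equiv.swap_apply_of_ne_of_ne h1.symm hpq
    · simp
  obtain ⟨r, hr, hrx, hre⟩ := exists_diagSU_of_angles hm hw hs σ
  refine ⟨r, hr, by rw [hre, hre, hσa, hσb, hxpq], ?_⟩
  simp only [spectralSelection, hrx, x, if_pos hij, lt_irrefl, if_false]
  intro h
  have h1 : Complex.exp (2 * Real.pi * Complex.I * ((v : ℝ) : ℂ))
      = Complex.exp (2 * Real.pi * Complex.I * ((-u : ℝ) : ℂ)) * -1 := by
    rw [← Complex.exp_pi_mul_I, ← Complex.exp_add]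
    congr 1
    have : (v : ℂ) = 1 / 2 - u := by
      have : v = 1 / 2 - u := by linarith
      rw [this]; push_cast; ring
    rw [this]
    push_cast
    ring
  rw [h1] at h
  have h2 := Complex.exp_ne_zero (2 * Real.pi * Complex.I * ((-u : ℝ) : ℂ))
  exact h2 (by linear_combination h / 2)

/-! ### Simultaneous diagonalization and maximal tori. -/

/-- A commuting family of Hermitian matrices is simultaneously unitarily diagonalizable. -/
theorem exists_unitary_diagonalizing_hermitian {n : ℕ} {ι : Type*} (A : ι → Mat n)
    (hA : ∀ i, (A i).IsHermitian) (hc : ∀ i j, A i * A j = A j * A i) :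
    ∃ g ∈ Matrix.unitaryGroup (Fin n) ℂ, ∀ i, ∃ d : Fin n → ℂ,
      A i * g = g * Matrix.diagonal d := by
  classical
  let T : ι → EuclideanSpace ℂ (Fin n) →ₗ[ℂ] EuclideanSpace ℂ (Fin n) :=
    fun i => (A i).toEuclideanLin
  have hT : ∀ i, (T i).IsSymmetric := fun i => Matrix.isSymmetric_toEuclideanLin_iff.2 (hA i)
  have hC : ∀ i j, Commute (T i) (T j) := by
    intro i j
    change (A i).toEuclideanLin ∘ₗ (A j).toEuclideanLin = (A j).toEuclideanLin ∘ₗ (A i).toEuclideanLin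
    rw [← Matrix.toLpLin_mul_same, ← Matrix.toLpLin_mul_same, hc]
  let V : (ι → ℂ) → Submodule ℂ (EuclideanSpace ℂ (Fin n)) :=
    fun χ => ⨅ i, Module.End.eigenspace (T i) (χ i)
  have hO : OrthogonalFamily ℂ (fun χ => V χ) fun χ => (V χ).subtypeₗᵢ :=
    LinearMap.IsSymmetric.orthogonalFamily_iInf_eigenspaces hT
  have hfin : {χ | V χ ≠ ⊥}.Finite := WellFoundedGT.finite_ne_bot_of_iSupIndep hO.independent
  have : Fintype {χ // V χ ≠ ⊥} := hfin.fintype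
  have hO' : OrthogonalFamily ℂ (fun χ : {χ // V χ ≠ ⊥} => V χ.1) fun χ => (V χ.1).subtypeₗᵢ :=
    hO.comp Subtype.val_injective
  have htop : ⨆ χ : {χ // V χ ≠ ⊥}, V χ.1 = ⊤ := by
    rw [iSup_ne_bot_subtype]
    exact LinearMap.IsSymmetric.iSup_iInf_eq_top_of_commute hT fun i j _ => hC i j
  have hI : DirectSum.IsInternal fun χ : {χ // V χ ≠ ⊥} => V χ.1 := by
    rw [hO'.isInternal_iff, htop, Submodule.top_orthogonal_eq_bot]
  have hr : Module.finrank ℂ (EuclideanSpace ℂ (Fin n)) = n := by simp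
  let e := hI.subordinateOrthonormalBasis hr hO'
  let χ := fun j => (hI.subordinateOrthonormalBasisIndex hr j hO').1
  have he : ∀ i j, T i (e j) = χ j i • e j := by
    intro i j
    have h1 : e j ∈ V (χ j) := hI.subordinateOrthonormalBasis_subordinate hr j hO'
    exact Module.End.mem_eigenspace_iff.1 ((Submodule.mem_iInf _).1 h1 i)
  refine ⟨(EuclideanSpace.basisFun (Fin n) ℂ).toBasis.toMatrix e,
    OrthonormalBasis.toMatrix_orthonormalBasis_mem_unitary _ _, fun i => ⟨fun j => χ j i, ?_⟩⟩
  ext p j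
  have h1 := congrArg (fun v : EuclideanSpace ℂ (Fin n) => v p) (he i j)
  simp only [T, Matrix.toLpLin_apply, PiLp.smul_apply, Matrix.mulVec, dotProduct] at h1
  rw [Matrix.mul_diagonal, Matrix.mul_apply]
  simp only [Module.Basis.toMatrix_apply, OrthonormalBasis.coe_toBasis_repr_apply,
    EuclideanSpace.basisFun_repr]
  rw [h1, smul_eq_mul, mul_comm]

/-- A unitary matrix can be rescaled to a special unitary one without affecting the matrices that it
diagonalizes. -/
theorem exists_SU_eq_mul_diagonal {n : ℕ} (hn : 0 < n) {g : Mat n}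
    (hg : g ∈ Matrix.unitaryGroup (Fin n) ℂ) :
    ∃ (h : SU n) (c : Fin n → ℂ), (h : Mat n) = g * Matrix.diagonal c := by
  have hd := Matrix.det_of_mem_unitary hg
  have hd1 : star g.det * g.det = 1 := hd.1
  let c : Fin n → ℂ := Function.update 1 ⟨0, hn⟩ (star g.det)
  refine ⟨⟨g * Matrix.diagonal c, ?_⟩, c, rfl⟩
  rw [Matrix.mem_specialUnitaryGroup_iff]
  constructor
  · refine mul_mem hg ?_
    rw [Matrix.mem_unitaryGroup_iff', Matrix.star_eq_conjTranspose,
      Matrix.diagonal_conjTranspose, Matrix.diagonal_mul_diagonal, ← Matrix.diagonal_one]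
    congr 1
    ext i
    by_cases hi : i = ⟨0, hn⟩
    · subst hi
      simpa [c] using (mul_comm _ _).trans hd1
    · simp [c, hi]
  · rw [Matrix.det_mul, Matrix.det_diagonal, Finset.prod_update_of_mem (Finset.mem_univ _)]
    simpa [mul_comm] using hd1

/-- A commutative subgroup of `SU(n)` is conjugate to a group of diagonal matrices. -/
theorem exists_conj_mem_diagSubgroup {n : ℕ} (hn : 0 < n) (H : Subgroup (SU n))
    (hH : ∀ X ∈ H, ∀ Y ∈ H, X * Y = Y * X) :
    ∃ g : SU n, ∀ X ∈ H, g⁻¹ * X * g ∈ diagSubgroup n := by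
  -- Each group element is recovered from two Hermitian matrices, so the Hermitian case applies.
  -- They all commute because `H` contains inverses, which are the adjoints.
  let A : H × Bool → Mat n := fun p =>
    if p.2 then (p.1.1 : Mat n) + star (p.1.1 : Mat n)
    else Complex.I • ((p.1.1 : Mat n) - star (p.1.1 : Mat n))
  have hA : ∀ p, (A p).IsHermitian := by
    rintro ⟨X, b⟩
    cases b
    · simp only [A, Matrix.IsHermitian, ← Matrix.star_eq_conjTranspose]
      simp [star_sub, star_smul, neg_smul, ← smul_neg]
    · simp only [A, Matrix.IsHermitian, ← Matrix.star_eq_conjTranspose]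
      simp [add_comm]
  have hc0 : ∀ X Y : H, (X.1 : Mat n) * (Y.1 : Mat n) = (Y.1 : Mat n) * (X.1 : Mat n) :=
    fun X Y => congrArg Subtype.val (hH X.1 X.2 Y.1 Y.2)
  have hc : ∀ p q, A p * A q = A q * A p := by
    rintro ⟨X, b⟩ ⟨Y, b'⟩
    have h1 : Commute (X.1 : Mat n) (Y.1 : Mat n) := hc0 X Y
    have h2 : Commute (X.1 : Mat n) (star (Y.1 : Mat n)) := hc0 X Y⁻¹
    have h3 : Commute (star (X.1 : Mat n)) (Y.1 : Mat n) := hc0 X⁻¹ Y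
    have h4 : Commute (star (X.1 : Mat n)) (star (Y.1 : Mat n)) := hc0 X⁻¹ Y⁻¹
    have hp : ∀ Z : Mat n, Commute (X.1 : Mat n) Z → Commute (star (X.1 : Mat n)) Z →
        Commute (A (X, b)) Z := by
      intro Z ha hb
      cases b
      · exact (ha.sub_left hb).smul_left _
      · exact ha.add_left hb
    have h5 := hp _ h1 h3
    have h6 := hp _ h2 h4
    cases b'
    · exact (h5.sub_right h6).smul_right _
    · exact h5.add_right h6
  obtain ⟨u, hu, hd⟩ := exists_unitary_diagonalizing_hermitian A hA hc
  obtain ⟨g, c, hg⟩ := exists_SU_eq_mul_diagonal hn hu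
  refine ⟨g, fun X hX => ?_⟩
  obtain ⟨d, hd1⟩ := hd (⟨X, hX⟩, true)
  obtain ⟨d', hd2⟩ := hd (⟨X, hX⟩, false)
  have hX2 : (X : Mat n) = (1 / 2 : ℂ) • A (⟨X, hX⟩, true)
      - (Complex.I / 2) • A (⟨X, hX⟩, false) := by
    simp only [A, if_true, Bool.false_eq_true, if_false, smul_smul]
    have : Complex.I / 2 * Complex.I = -(1 / 2) := by
      rw [div_mul_eq_mul_div, Complex.I_mul_I]; norm_num
    rw [this]
    module
  have hXu : (X : Mat n) * u = u * Matrix.diagonal ((1 / 2 : ℂ) • d - (Complex.I / 2) • d') := by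
    rw [hX2, sub_mul, smul_mul_assoc, smul_mul_assoc, hd1, hd2, ← mul_smul_comm, ← mul_smul_comm,
      ← mul_sub, ← Matrix.diagonal_smul, ← Matrix.diagonal_smul, Matrix.diagonal_sub]
    rfl
  rw [mem_diagSubgroup]
  have h1 : ((g⁻¹ * X * g : SU n) : Mat n) = star (g : Mat n) * ((X : Mat n) * (g : Mat n)) := by
    rw [← mul_assoc]; rfl
  rw [h1, hg, ← mul_assoc (X : Mat n), hXu, mul_assoc, Matrix.diagonal_mul_diagonal]
  -- The diagonal factors are swapped so that `u * diagonal c` reassembles into `g`.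
  simp only [mul_comm _ (c _)]
  rw [← Matrix.diagonal_mul_diagonal, ← mul_assoc u, ← hg, ← mul_assoc, SU.star_mul_self, one_mul]
  exact Matrix.isDiag_diagonal _

theorem diagSubgroup_comm {n : ℕ} {X Y : SU n} (hX : X ∈ diagSubgroup n)
    (hY : Y ∈ diagSubgroup n) : X * Y = Y * X := by
  apply Subtype.ext
  change (X : Mat n) * (Y : Mat n) = (Y : Mat n) * (X : Mat n)
  rw [← Matrix.IsDiag.diagonal_diag hX, ← Matrix.IsDiag.diagonal_diag hY,
    Matrix.diagonal_mul_diagonal, Matrix.diagonal_mul_diagonal]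
  simp only [mul_comm]

theorem IsTorus.comm {G : Type*} [Group G] [TopologicalSpace G] {H : Subgroup G}
    (hH : IsTorus H) {X Y : G} (hX : X ∈ H) (hY : Y ∈ H) : X * Y = Y * X := by
  obtain ⟨k, ⟨e⟩⟩ := hH
  have h : (⟨X, hX⟩ * ⟨Y, hY⟩ : H) = ⟨Y, hY⟩ * ⟨X, hX⟩ := by
    apply e.injective
    rw [map_mul, map_mul, mul_comm]
  exact congrArg Subtype.val h

theorem diagSU_congr {n : ℕ} {z w : Fin n → Circle} (h : z = w) (hz : ∏ i, z i = 1) :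
    diagSU w (h ▸ hz) = diagSU z hz := by
  subst h
  rfl

theorem eq_snoc_of_prod_eq_one {m : ℕ} {z : Fin (m + 1) → Circle} (hz : ∏ i, z i = 1)
    {w : Fin m → Circle} (hw : ∀ i, w i = z i.castSucc) :
    z = Fin.snoc (α := fun _ => Circle) w (∏ i, w i)⁻¹ := by
  rw [Fin.prod_univ_castSucc] at hz
  ext1 i
  refine Fin.lastCases ?_ (fun i => ?_) i
  · rw [Fin.snoc_last, eq_inv_iff_mul_eq_one, mul_comm]
    simpa only [hw] using hz
  · rw [Fin.snoc_castSucc, hw]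

/-- The diagonal subgroup of `SU(m+1)` is parametrized by the first `m` diagonal entries. -/
noncomputable def diagSubgroupEquiv (m : ℕ) : (Fin m → Circle) ≃* diagSubgroup (m + 1) where
  toFun z := ⟨diagSU (Fin.snoc z (∏ i, z i)⁻¹ : Fin (m + 1) → Circle)
    (by rw [Fin.prod_univ_castSucc]; simp), diagSU_mem _ _⟩
  invFun X i := ⟨(X.1 : Mat (m + 1)) i.castSucc i.castSucc, mem_sphere_zero_iff_norm.2
    (norm_apply_self_of_mem_diagSubgroup X.2 _)⟩
  left_inv z := by
    ext i
    simp [diagSU]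
  right_inv := by
    rintro ⟨X, hX⟩
    obtain ⟨z, hz, rfl⟩ := exists_eq_diagSU hX
    exact Subtype.ext (diagSU_congr (eq_snoc_of_prod_eq_one hz fun i =>
      Circle.ext (Matrix.diagonal_apply_eq _ _)) hz)
  map_mul' z w := by
    apply Subtype.ext
    apply Subtype.ext
    change Matrix.diagonal _ = Matrix.diagonal _ * Matrix.diagonal _
    rw [Matrix.diagonal_mul_diagonal]
    congr 1
    ext i
    refine Fin.lastCases ?_ (fun i => ?_) i
    · simp [Finset.prod_mul_distrib, mul_comm]
    · simp

theorem continuous_diagSubgroupEquiv (m : ℕ) : Continuous (diagSubgroupEquiv m) := by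
  refine Continuous.subtype_mk (Continuous.subtype_mk (Continuous.matrix_diagonal
    (continuous_pi fun i => ?_)) _) _
  refine Fin.lastCases ?_ (fun i => ?_) i
  · simp only [Fin.snoc_last]
    fun_prop
  · simp only [Fin.snoc_castSucc]
    fun_prop

theorem continuous_diagSubgroupEquiv_symm (m : ℕ) : Continuous (diagSubgroupEquiv m).symm := by
  refine continuous_pi fun i => Continuous.subtype_mk ?_ _
  exact (continuous_subtype_val.comp continuous_subtype_val).matrix_elem _ _

/-- Needed to invoke maximality: a torus that a conjugation carries into the diagonal group lies in
this subgroup. -/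
theorem isTorus_map_conj_diagSubgroup {n : ℕ} (hn : 0 < n) (g : SU n) :
    IsTorus ((diagSubgroup n).map (MulAut.conj g).toMonoidHom) := by
  obtain ⟨m, rfl⟩ : ∃ m, n = m + 1 := ⟨n - 1, by omega⟩
  let e := (MulAut.conj g).subgroupMap (diagSubgroup (m + 1))
  have hconj : ∀ h : SU (m + 1), Continuous fun X : SU (m + 1) => h * X * h⁻¹ :=
    fun h => (continuous_const.mul continuous_id).mul continuous_const
  have h1 : Continuous e := Continuous.subtype_mk ((hconj g).comp continuous_subtype_val) _
  have h2 : Continuous e.symm := by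
    refine continuous_induced_rng.2 ?_
    have : (Subtype.val ∘ e.symm) = fun X => g⁻¹ * X.1 * g⁻¹⁻¹ := by
      ext1 X
      obtain ⟨Y, rfl⟩ := e.surjective X
      simp only [Function.comp_apply, MulEquiv.symm_apply_apply]
      change Y.1 = g⁻¹ * (g * Y.1 * g⁻¹) * g⁻¹⁻¹
      group
    rw [this]
    exact (hconj g⁻¹).comp continuous_subtype_val
  exact ⟨m, ⟨ContinuousMulEquiv.symm ⟨(diagSubgroupEquiv m).trans e,
    h1.comp (continuous_diagSubgroupEquiv m), (continuous_diagSubgroupEquiv_symm m).comp h2⟩⟩⟩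

/-- Every maximal torus of `SU(n)` contains a conjugate of the diagonal torus. -/
theorem IsMaximalTorus.exists_conj_mem {n : ℕ} (hn : 0 < n) {H : Subgroup (SU n)}
    (hH : IsMaximalTorus H) : ∃ g : SU n, ∀ t ∈ diagSubgroup n, g * t * g⁻¹ ∈ H := by
  obtain ⟨g, hg⟩ := exists_conj_mem_diagSubgroup hn H fun X hX Y hY => hH.1.comm hX hY
  refine ⟨g, fun t ht => ?_⟩
  refine hH.2 (isTorus_map_conj_diagSubgroup hn g) (fun X hX => ?_) ⟨t, ht, rfl⟩
  exact ⟨g⁻¹ * X * g, hg X hX, by simp [mul_assoc]⟩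

/-- A larger torus is commutative, so it centralizes `diag(-i, i)`, whose distinct entries force its
centralizer to be diagonal. -/
theorem isMaximalTorus_diagSubgroup_two : IsMaximalTorus (diagSubgroup 2) := by
  refine ⟨?_, fun H hH hle X hX => ?_⟩
  · have h := isTorus_map_conj_diagSubgroup two_pos (1 : SU 2)
    have h1 : (diagSubgroup 2).map (MulAut.conj (1 : SU 2)).toMonoidHom = diagSubgroup 2 := by
      ext X
      simp
    rwa [h1] at h
  · obtain ⟨r, hr, -, hre⟩ := exists_diagSU_of_angles (n := 2) (x := ![-(1 / 4), 1 / 4])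
      (by intro i j; fin_cases i <;> fin_cases j <;> simp)
      (by intro i j; fin_cases i <;> fin_cases j <;> simp <;> norm_num) (by simp) 1
    have h0 := hre 0
    have h1 := hre 1
    have hne : (r : Mat 2) 0 0 ≠ (r : Mat 2) 1 1 := by
      rw [h0, h1]
      have e0 : (2 * Real.pi * Complex.I * ((![-(1 / 4 : ℝ), 1 / 4] ((1 : Equiv.Perm (Fin 2)) 0) : ℝ) : ℂ)
        : ℂ) = -(Real.pi / 2 * Complex.I) := by simp; ring
      have e1 : (2 * Real.pi * Complex.I * ((![-(1 / 4 : ℝ), 1 / 4] ((1 : Equiv.Perm (Fin 2)) 1) : ℝ) : ℂ)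
        : ℂ) = (Real.pi / 2 * Complex.I) := by simp; ring
      rw [e0, e1, Complex.exp_neg, Complex.exp_pi_div_two_mul_I, Complex.inv_I]
      intro h
      exact Complex.I_ne_zero (by linear_combination -h / 2)
    have hc := congrArg Subtype.val (hH.comm hX (hle hr))
    have hc' : (X : Mat 2) * (r : Mat 2) = (r : Mat 2) * (X : Mat 2) := hc
    rw [← Matrix.IsDiag.diagonal_diag hr] at hc'
    intro i j hij
    have h2 := congrFun (congrFun hc' i) j
    rw [Matrix.mul_diagonal, Matrix.diagonal_mul, Matrix.diag_apply, Matrix.diag_apply] at h2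
    have h3 : (X : Mat 2) i j * ((r : Mat 2) j j - (r : Mat 2) i i) = 0 := by
      linear_combination h2
    refine (mul_eq_zero.1 h3).resolve_right (sub_ne_zero.2 ?_)
    fin_cases i <;> fin_cases j
    · exact absurd rfl hij
    · exact hne.symm
    · exact hne
    · exact absurd rfl hij

/-! ### Coordinate blocks, plane rotations and Jacobi diagonalization. -/

open Matrix in
/-- The isometric coordinate inclusion along an injection `s`. -/
def coordIncl {n m : ℕ} (s : Fin m → Fin n) : Matrix (Fin n) (Fin m) ℂ :=
  (1 : Matrix (Fin n) (Fin n) ℂ).submatrix id s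

open Matrix in
theorem coordIncl_conjTranspose_mul_self {n m : ℕ} {s : Fin m → Fin n}
    (hs : Function.Injective s) : (coordIncl s)ᴴ * coordIncl s = 1 := by
  ext p q
  simp [coordIncl, Matrix.mul_apply, Matrix.one_apply, hs.eq_iff, eq_comm]

open Matrix in
theorem diagonal_mul_coordIncl {n m : ℕ} (s : Fin m → Fin n) (d : Fin n → ℂ) :
    diagonal d * coordIncl s = coordIncl s * diagonal (d ∘ s) := by
  ext p q
  by_cases h : p = s q <;> simp [coordIncl, Matrix.one_apply, h]

open Matrix in
theorem coordIncl_conjTranspose_mul_diagonal {n m : ℕ} (s : Fin m → Fin n) (d : Fin n → ℂ) :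
    (coordIncl s)ᴴ * diagonal d = diagonal (d ∘ s) * (coordIncl s)ᴴ := by
  ext p q
  by_cases h : s p = q <;> simp [coordIncl, Matrix.one_apply, h]

open Matrix in
theorem coordIncl_conjTranspose_mul_mul {n m : ℕ} (s : Fin m → Fin n) (B : Mat n) :
    (coordIncl s)ᴴ * B * coordIncl s = B.submatrix s s := by
  ext p q
  simp [coordIncl, Matrix.mul_apply, Matrix.one_apply]

open Matrix in
/-- The matrix acting as `K` on the coordinates selected by `s` and trivially on the others. -/
def coordEmb {n m : ℕ} (s : Fin m → Fin n) (K : Mat m) : Mat n :=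
  1 + coordIncl s * (K - 1) * (coordIncl s)ᴴ

open Matrix in
theorem coordEmb_mul {n m : ℕ} {s : Fin m → Fin n} (hs : Function.Injective s) (K L : Mat m) :
    coordEmb s K * coordEmb s L = coordEmb s (K * L) := by
  have h : coordIncl s * (K - 1) * (coordIncl s)ᴴ * (coordIncl s * (L - 1) * (coordIncl s)ᴴ)
      = coordIncl s * ((K - 1) * (L - 1)) * (coordIncl s)ᴴ := by
    calc _ = coordIncl s * (K - 1) * ((coordIncl s)ᴴ * coordIncl s) * (L - 1) * (coordIncl s)ᴴ := by
          simp only [Matrix.mul_assoc]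
      _ = _ := by rw [coordIncl_conjTranspose_mul_self hs]; simp only [Matrix.mul_assoc, mul_one]
  have h2 : K * L - 1 = (K - 1) + (L - 1) + (K - 1) * (L - 1) := by noncomm_ring
  rw [coordEmb, coordEmb, coordEmb, add_mul, one_mul, mul_add, mul_one, h, h2,
    Matrix.mul_add, Matrix.mul_add, Matrix.add_mul, Matrix.add_mul]
  abel

open Matrix in
theorem coordEmb_star {n m : ℕ} (s : Fin m → Fin n) (K : Mat m) :
    star (coordEmb s K) = coordEmb s (star K) := by
  simp [coordEmb, Matrix.star_eq_conjTranspose, Matrix.mul_assoc]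

open Matrix in
theorem coordEmb_one {n m : ℕ} (s : Fin m → Fin n) : coordEmb s (1 : Mat m) = 1 := by
  simp [coordEmb]

-- Sylvester's identity `det (1 + AB) = det (1 + BA)` moves the computation to size `m`.
open Matrix in
theorem coordEmb_det {n m : ℕ} {s : Fin m → Fin n} (hs : Function.Injective s) (K : Mat m) :
    (coordEmb s K).det = K.det := by
  rw [coordEmb, Matrix.mul_assoc, det_one_add_mul_comm, Matrix.mul_assoc,
    coordIncl_conjTranspose_mul_self hs, mul_one, add_sub_cancel]

/-- The embedding of `SU(m)` into `SU(n)` along an injection of coordinates. -/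
def coordEmbSU {n m : ℕ} {s : Fin m → Fin n} (hs : Function.Injective s) (K : SU m) : SU n :=
  ⟨coordEmb s K, by
    rw [Matrix.mem_specialUnitaryGroup_iff, Matrix.mem_unitaryGroup_iff, coordEmb_star,
      coordEmb_mul hs, coordEmb_det hs, SU.mul_star_self, coordEmb_one]
    exact ⟨rfl, (Matrix.mem_specialUnitaryGroup_iff.1 K.2).2⟩⟩

open Matrix in
theorem continuous_coordEmbSU {n m : ℕ} {s : Fin m → Fin n} (hs : Function.Injective s) :
    Continuous (coordEmbSU hs) := by
  refine Continuous.subtype_mk (continuous_const.add ?_) _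
  exact (continuous_const.matrix_mul (continuous_subtype_val.sub continuous_const)).matrix_mul
    continuous_const

theorem coordEmbSU_one {n m : ℕ} {s : Fin m → Fin n} (hs : Function.Injective s) :
    coordEmbSU hs 1 = 1 := Subtype.ext (coordEmb_one s)

-- On the selected coordinates `r` is the scalar `c`, and on the others the embedded matrix is the
-- identity.
open Matrix in
theorem coordEmbSU_comm {n m : ℕ} {s : Fin m → Fin n} (hs : Function.Injective s) (K : SU m)
    {r : SU n} (hr : r ∈ diagSubgroup n) (c : ℂ) (hc : ∀ p, (r : Mat n) (s p) (s p) = c) :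
    coordEmbSU hs K * r = r * coordEmbSU hs K := by
  apply Subtype.ext
  change coordEmb s (K : Mat m) * (r : Mat n) = (r : Mat n) * coordEmb s (K : Mat m)
  rw [← Matrix.IsDiag.diagonal_diag hr, coordEmb, add_mul, mul_add, one_mul, mul_one,
    Matrix.mul_assoc, coordIncl_conjTranspose_mul_diagonal, Matrix.mul_assoc,
    ← Matrix.mul_assoc (diagonal _) (coordIncl s * _), ← Matrix.mul_assoc (diagonal _) (coordIncl s),
    diagonal_mul_coordIncl]
  have h : diagonal ((r : Mat n).diag ∘ s) = c • (1 : Mat m) := by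
    rw [smul_one_eq_diagonal]
    congr 1
    ext p
    exact hc p
  rw [h]
  simp [Matrix.mul_assoc]

-- Only the selected block changes, which reduces the trace variation in Jacobi's method to a 2 × 2
-- computation.
open Matrix in
theorem coordEmb_mul_diagonal_mul_star {n m : ℕ} {s : Fin m → Fin n} (hs : Function.Injective s)
    (K : Mat m) (d : Fin n → ℂ) :
    coordEmb s K * diagonal d * star (coordEmb s K) = diagonal d
      + coordIncl s * (K * diagonal (d ∘ s) * star K - diagonal (d ∘ s)) * (coordIncl s)ᴴ := by
  have h1 : coordEmb s K * diagonal d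
      = diagonal d + coordIncl s * ((K - 1) * diagonal (d ∘ s)) * (coordIncl s)ᴴ := by
    rw [coordEmb, add_mul, one_mul, Matrix.mul_assoc, coordIncl_conjTranspose_mul_diagonal]
    simp only [Matrix.mul_assoc]
  have h2 : diagonal d * (coordIncl s * (star K - 1) * (coordIncl s)ᴴ)
      = coordIncl s * (diagonal (d ∘ s) * (star K - 1)) * (coordIncl s)ᴴ := by
    rw [← Matrix.mul_assoc, ← Matrix.mul_assoc, diagonal_mul_coordIncl]
    simp only [Matrix.mul_assoc]
  have h3 : coordIncl s * ((K - 1) * diagonal (d ∘ s)) * (coordIncl s)ᴴ *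
      (coordIncl s * (star K - 1) * (coordIncl s)ᴴ)
      = coordIncl s * ((K - 1) * diagonal (d ∘ s) * (star K - 1)) * (coordIncl s)ᴴ := by
    calc _ = coordIncl s * ((K - 1) * diagonal (d ∘ s)) * ((coordIncl s)ᴴ * coordIncl s)
            * (star K - 1) * (coordIncl s)ᴴ := by
          simp only [Matrix.mul_assoc]
      _ = _ := by rw [coordIncl_conjTranspose_mul_self hs]; simp only [Matrix.mul_assoc, one_mul]
  have h4 : K * diagonal (d ∘ s) * star K - diagonal (d ∘ s)
      = (K - 1) * diagonal (d ∘ s) + diagonal (d ∘ s) * (star K - 1)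
        + (K - 1) * diagonal (d ∘ s) * (star K - 1) := by noncomm_ring
  rw [h1, coordEmb_star, coordEmb, add_mul, mul_add, mul_add, mul_one, mul_one, h2, h3, h4,
    Matrix.mul_add, Matrix.mul_add, Matrix.add_mul, Matrix.add_mul]
  abel

/-- The rotation of the plane through the angle `θ`, with phase `z`. -/
noncomputable def planeRotation (z : Circle) (θ : ℝ) : SU 2 :=
  ⟨!![(Real.cos θ : ℂ), -(star (z : ℂ) * Real.sin θ); z * Real.sin θ, (Real.cos θ : ℂ)], by
    have hz : (z : ℂ) * star (z : ℂ) = 1 := by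
      rw [RCLike.star_def, Complex.mul_conj, Circle.normSq_coe, Complex.ofReal_one]
    have h1 : (Real.cos θ : ℂ) ^ 2 + (Real.sin θ : ℂ) ^ 2 = 1 := by
      exact_mod_cast Real.cos_sq_add_sin_sq θ
    rw [Matrix.mem_specialUnitaryGroup_iff, Matrix.mem_unitaryGroup_iff]
    constructor
    · ext i j
      fin_cases i <;> fin_cases j <;>
        simp [Matrix.mul_apply, Fin.sum_univ_two, -Complex.ofReal_cos, -Complex.ofReal_sin] <;>
        simp only [RCLike.star_def] at hz
      · linear_combination h1 + (Real.sin θ : ℂ) ^ 2 * hz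
      · ring
      · ring
      · linear_combination h1 + (Real.sin θ : ℂ) ^ 2 * hz
    · rw [Matrix.det_fin_two_of]
      linear_combination h1 + (Real.sin θ : ℂ) ^ 2 * hz⟩

theorem continuous_planeRotation (z : Circle) : Continuous (planeRotation z) := by
  refine Continuous.subtype_mk (continuous_matrix fun i j => ?_) _
  fin_cases i <;> fin_cases j <;> simp <;> fun_prop

theorem planeRotation_zero (z : Circle) : planeRotation z 0 = 1 := by
  apply Subtype.ext
  ext i j
  fin_cases i <;> fin_cases j <;> simp [planeRotation]

-- A polynomial identity, with `w'` in the role of the conjugate of the phase `w` and `c`, `t` as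
-- cosine and sine.
open Matrix in
theorem trace_rotation_two {w w' c t N : ℂ} {B : Mat 2} (hz : w * w' = 1) (h1 : c ^ 2 + t ^ 2 = 1)
    (hb : w * B 0 1 = N) (hb' : w' * B 1 0 = N) (d : Fin 2 → ℂ) :
    ((!![c, -(w' * t); w * t, c] * diagonal d * !![c, w' * t; -(w * t), c] - diagonal d) * B).trace
      = (d 0 - d 1) * (t ^ 2 * (B 1 1 - B 0 0) + 2 * (c * t) * N) := by
  have hd : diagonal d = !![d 0, 0; 0, d 1] := by
    rw [Matrix.eta_fin_two (diagonal d)]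
    simp
  rw [hd, Matrix.eta_fin_two B]
  simp only [Matrix.mul_fin_two, Matrix.trace_fin_two_of, Matrix.of_sub_of,
    Matrix.cons_sub_cons, Matrix.empty_sub_empty, Matrix.of_apply, Matrix.cons_val',
    Matrix.cons_val_zero, Matrix.cons_val_one]
  linear_combination (d 0 * B 0 0 + d 1 * B 1 1) * h1
    + (t ^ 2 * d 1 * B 0 0 + t ^ 2 * d 0 * B 1 1) * hz
    + c * t * (d 0 - d 1) * hb + c * t * (d 0 - d 1) * hb'

open Matrix in
/-- The first-order condition behind the Jacobi diagonalization procedure. -/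
theorem trace_planeRotation {B : Mat 2} (hB : B.IsHermitian) (h0 : B 0 1 ≠ 0) :
    ∃ z : Circle, ∀ (d : Fin 2 → ℝ) (θ : ℝ),
      (((planeRotation z θ : Mat 2) * diagonal (fun i => (d i : ℂ)) * star (planeRotation z θ : Mat 2)
        - diagonal (fun i => (d i : ℂ))) * B).trace.re
      = (d 0 - d 1) * (Real.sin θ ^ 2 * ((B 1 1).re - (B 0 0).re)
        + 2 * (Real.cos θ * Real.sin θ) * ‖B 0 1‖) := by
  have hn : ‖B 0 1‖ ≠ 0 := norm_ne_zero_iff.2 h0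
  have hn' : (‖B 0 1‖ : ℂ) ≠ 0 := by exact_mod_cast hn
  -- This phase turns the off-diagonal entry into its modulus, so the term linear in `θ` does not
  -- vanish.
  let z : Circle := ⟨star (B 0 1) / ‖B 0 1‖, mem_sphere_zero_iff_norm.2 (by simp [hn])⟩
  refine ⟨z, fun d θ => ?_⟩
  have hz : (z : ℂ) * star (z : ℂ) = 1 := by
    rw [RCLike.star_def, Complex.mul_conj, Circle.normSq_coe, Complex.ofReal_one]
  have hzb : (z : ℂ) * B 0 1 = ‖B 0 1‖ := by
    change star (B 0 1) / ‖B 0 1‖ * B 0 1 = ‖B 0 1‖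
    rw [div_mul_eq_mul_div, div_eq_iff hn', RCLike.star_def, mul_comm, Complex.mul_conj',
      sq]
  have h10 : B 1 0 = star (B 0 1) := (hB.apply 1 0).symm
  have hzb' : star (z : ℂ) * B 1 0 = ‖B 0 1‖ := by
    rw [h10, mul_comm, ← star_mul, hzb, RCLike.star_def, Complex.conj_ofReal]
  have h1 : (Real.cos θ : ℂ) ^ 2 + (Real.sin θ : ℂ) ^ 2 = 1 := by
    exact_mod_cast Real.cos_sq_add_sin_sq θ
  have key : (((planeRotation z θ : Mat 2) * diagonal (fun i => (d i : ℂ))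
        * star (planeRotation z θ : Mat 2) - diagonal (fun i => (d i : ℂ))) * B).trace
      = ((d 0 - d 1 : ℝ) : ℂ) * (((Real.sin θ ^ 2 : ℝ) : ℂ) * (B 1 1 - B 0 0)
        + ((2 * (Real.cos θ * Real.sin θ) * ‖B 0 1‖ : ℝ) : ℂ)) := by
    have hK : (planeRotation z θ : Mat 2) =
      !![(Real.cos θ : ℂ), -(star (z : ℂ) * Real.sin θ); z * Real.sin θ, (Real.cos θ : ℂ)] := rfl
    rw [hK]
    have hKs : star !![(Real.cos θ : ℂ), -(star (z : ℂ) * Real.sin θ);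
        z * Real.sin θ, (Real.cos θ : ℂ)] = !![(Real.cos θ : ℂ), star (z : ℂ) * Real.sin θ;
        -(z * Real.sin θ), (Real.cos θ : ℂ)] := by
      ext i j
      fin_cases i <;> fin_cases j <;>
        simp [Matrix.star_apply, -Complex.ofReal_cos, -Complex.ofReal_sin]
    rw [hKs, trace_rotation_two hz h1 hzb hzb']
    push_cast
    ring
  rw [key, Complex.re_ofReal_mul, Complex.add_re, Complex.re_ofReal_mul, Complex.sub_re,
    Complex.ofReal_re]

open Matrix in
/-- Jacobi diagonalization: a closed set of special unitary matrices that is stable under right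
multiplication by plane rotations diagonalizes every Hermitian matrix. -/
theorem exists_isDiag_of_planeRotation_invariant {n : ℕ} {S : Set (SU n)} (hS : IsClosed S)
    (hne : S.Nonempty)
    (hinv : ∀ h ∈ S, ∀ (s : Fin 2 → Fin n) (hs : Function.Injective s) (z : Circle) (θ : ℝ),
      h * coordEmbSU hs (planeRotation z θ) ∈ S)
    {Y : Mat n} (hY : Y.IsHermitian) : ∃ h ∈ S, (star (h : Mat n) * Y * (h : Mat n)).IsDiag := by
  -- The distinct entries of `D` ensure that at a maximum of `F` every off-diagonal entry must
  -- vanish.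
  let D : Mat n := diagonal fun i => (((i : ℕ) : ℝ) : ℂ)
  let F : SU n → ℝ := fun h => (D * (star (h : Mat n) * Y * (h : Mat n))).trace.re
  have hF : Continuous F := by
    refine Complex.continuous_re.comp (Continuous.matrix_trace ?_)
    refine continuous_const.matrix_mul (Continuous.matrix_mul (Continuous.matrix_mul ?_
      continuous_const) continuous_subtype_val)
    exact continuous_subtype_val.matrix_conjTranspose
  obtain ⟨h, hh, hmax⟩ := hS.isCompact.exists_isMaxOn hne hF.continuousOn
  refine ⟨h, hh, fun a b hab => ?_⟩
  set B : Mat n := star (h : Mat n) * Y * (h : Mat n) with hBdef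
  have hB : B.IsHermitian := Matrix.isHermitian_conjTranspose_mul_mul _ hY
  by_contra h0
  let s : Fin 2 → Fin n := ![a, b]
  have hs : Function.Injective s := by
    intro i j
    fin_cases i <;> fin_cases j <;> simp [s, hab, hab.symm]
  obtain ⟨z, hz⟩ := trace_planeRotation (B := B.submatrix s s) (hB.submatrix s) h0
  have hle : ∀ θ : ℝ, (((a : ℕ) : ℝ) - ((b : ℕ) : ℝ)) *
      (Real.sin θ ^ 2 * ((B b b).re - (B a a).re)
        + 2 * (Real.cos θ * Real.sin θ) * ‖B a b‖) ≤ 0 := by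
    intro θ
    have h1 : F (h * coordEmbSU hs (planeRotation z θ)) ≤ F h := hmax (hinv h hh s hs z θ)
    have h2 := hz (fun i => ((s i : ℕ) : ℝ)) θ
    set K : Mat 2 := (planeRotation z θ : Mat 2)
    have h3 : F (h * coordEmbSU hs (planeRotation z θ)) = F h + ((K * diagonal (fun i => (((s i : ℕ) : ℝ) : ℂ)) * star K
        - diagonal (fun i => (((s i : ℕ) : ℝ) : ℂ))) * B.submatrix s s).trace.re := by
      simp only [F]
      rw [← Complex.add_re]
      congr 1
      have h4 : ((h * coordEmbSU hs (planeRotation z θ) : SU n) : Mat n)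
        = (h : Mat n) * coordEmb s K := rfl
      rw [h4, star_mul]
      -- Cyclicity of the trace transfers the rotation from `B` to the diagonal matrix `D`.
      have h5 : D * (star (coordEmb s K) * star (h : Mat n) * Y * ((h : Mat n) * coordEmb s K))
        = (D * star (coordEmb s K) * B) * coordEmb s K := by
        simp only [hBdef, mul_assoc]
      rw [h5, Matrix.trace_mul_comm, ← mul_assoc _ _ B, ← mul_assoc _ D,
        coordEmb_mul_diagonal_mul_star hs, add_mul, trace_add, ← coordIncl_conjTranspose_mul_mul]
      congr 1
      rw [Matrix.mul_assoc, Matrix.mul_assoc, Matrix.trace_mul_comm, Matrix.mul_assoc]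
      rfl
    rw [h2] at h3
    have h6 : F h + _ ≤ F h := h3 ▸ h1
    exact (add_le_iff_nonpos_right _).1 h6
  -- The variation is maximal at `θ = 0`, yet its derivative there is `2 (a - b) ‖B a b‖ ≠ 0`.
  have hloc : IsLocalMax (fun θ : ℝ => (((a : ℕ) : ℝ) - ((b : ℕ) : ℝ)) *
      (Real.sin θ ^ 2 * ((B b b).re - (B a a).re)
        + 2 * (Real.cos θ * Real.sin θ) * ‖B a b‖)) 0 := by
    refine Filter.Eventually.of_forall fun θ => ?_
    simpa using hle θ
  have hder : HasDerivAt (fun θ : ℝ => (((a : ℕ) : ℝ) - ((b : ℕ) : ℝ)) *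
      (Real.sin θ ^ 2 * ((B b b).re - (B a a).re)
        + 2 * (Real.cos θ * Real.sin θ) * ‖B a b‖))
      ((((a : ℕ) : ℝ) - ((b : ℕ) : ℝ)) * (2 * ‖B a b‖)) 0 := by
    have hs := Real.hasDerivAt_sin 0
    have hc := Real.hasDerivAt_cos 0
    exact ((((hs.pow 2).mul_const ((B b b).re - (B a a).re)).add
      (((hc.mul hs).const_mul 2).mul_const ‖B a b‖)).const_mul
      (((a : ℕ) : ℝ) - ((b : ℕ) : ℝ))).congr_deriv (by simp)
  have h0' := hloc.hasDerivAt_eq_zero hder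
  have hab' : ((a : ℕ) : ℝ) - ((b : ℕ) : ℝ) ≠ 0 :=
    sub_ne_zero.2 (by exact_mod_cast fun h => hab (Fin.ext h))
  have := norm_ne_zero_iff.2 h0
  exact (mul_ne_zero hab' (mul_ne_zero two_ne_zero this)) h0'

/-! ### From one torus to the whole group. -/

/-- A continuous family of diagonal entries with values in a fixed finite set is constant. -/
theorem eq_of_continuous_of_mem_finite {f : ℝ → ℂ} (hf : Continuous f) {s : Set ℂ}
    (hs : s.Finite) (hfs : ∀ x, f x ∈ s) (x y : ℝ) : f x = f y := by
  have : Finite s := hs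
  have h := PreconnectedSpace.constant (α := ℝ) (Y := s) inferInstance
    (f := fun x => ⟨f x, hfs x⟩) (hf.subtype_mk hfs) (x := x) (y := y)
  exact congrArg Subtype.val h

/-- The image commutes with `diag(λ(r))` for every diagonal `r` that agrees at the two coordinates
of `s`, and any two positions are separated by some such `r`. -/
theorem isDiag_of_reorders_of_coordEmb {n : ℕ} (hn : 3 ≤ n) {ψ : SU n → Mat n}
    (hcomm : CommutativityPreserving ψ) {g : SU n}
    (hg : ∀ t ∈ diagSubgroup n, ψ (g * t * g⁻¹) = Matrix.diagonal (spectralSelection t))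
    {s : Fin 2 → Fin n} (hs : Function.Injective s) (K : SU 2) {t : SU n}
    (ht : t ∈ diagSubgroup n) :
    (ψ ((g * coordEmbSU hs K) * t * (g * coordEmbSU hs K)⁻¹)).IsDiag := by
  set k := coordEmbSU hs K with hk
  have key : ∀ (i j : Fin n) (r : SU n), r ∈ diagSubgroup n →
      (r : Mat n) (s 0) (s 0) = (r : Mat n) (s 1) (s 1) →
      spectralSelection r i ≠ spectralSelection r j →
      ψ ((g * k) * t * (g * k)⁻¹) i j = 0 := by
    intro i j r hr hrs hne
    have hkr : Commute k r := coordEmbSU_comm hs K hr ((r : Mat n) (s 0) (s 0)) (by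
      intro p
      fin_cases p
      · rfl
      · exact hrs.symm)
    have htr : Commute t r := diagSubgroup_comm ht hr
    have h1 : Commute (k * t * k⁻¹) r := (hkr.mul_left htr).mul_left hkr.inv_left
    have h2 := hcomm ((g * k) * t * (g * k)⁻¹) (g * r * g⁻¹) (by
      have := h1.eq
      calc (g * k) * t * (g * k)⁻¹ * (g * r * g⁻¹) = g * (k * t * k⁻¹ * r) * g⁻¹ := by group
        _ = g * (r * (k * t * k⁻¹)) * g⁻¹ := by rw [this]
        _ = _ := by group)
    rw [hg r hr] at h2
    have h3 := congrFun (congrFun h2 i) j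
    rw [Matrix.mul_diagonal, Matrix.diagonal_mul] at h3
    have h4 : ψ ((g * k) * t * (g * k)⁻¹) i j * (spectralSelection r i - spectralSelection r j)
        = 0 := by linear_combination -h3
    exact (mul_eq_zero.1 h4).resolve_right (sub_ne_zero.2 hne)
  intro i j hij
  have hs01 : s 0 ≠ s 1 := fun h => by simpa using hs h
  rcases lt_or_gt_of_ne hij with h | h
  · obtain ⟨r, hr, hrs, hne⟩ := exists_mem_diagSubgroup_separating hn hs01 h
    exact key i j r hr hrs hne
  · obtain ⟨r, hr, hrs, hne⟩ := exists_mem_diagSubgroup_separating hn hs01 h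
    exact key i j r hr hrs hne.symm

/-- Commutation gives diagonality along the whole rotation path; discreteness of the spectrum then
freezes the order of the eigenvalues. -/
theorem reorders_mul_planeRotation {n : ℕ} (hn : 3 ≤ n) {ψ : SU n → Mat n}
    (hcont : Continuous ψ) (hspec : SpectrumPreserving ψ)
    (hcomm : CommutativityPreserving ψ) {g : SU n}
    (hg : ∀ t ∈ diagSubgroup n, ψ (g * t * g⁻¹) = Matrix.diagonal (spectralSelection t))
    {s : Fin 2 → Fin n} (hs : Function.Injective s) (z : Circle) (θ : ℝ) :
    ∀ t ∈ diagSubgroup n, ψ ((g * coordEmbSU hs (planeRotation z θ)) * t *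
      (g * coordEmbSU hs (planeRotation z θ))⁻¹) = Matrix.diagonal (spectralSelection t) := by
  intro t ht
  let k : ℝ → SU n := fun θ => coordEmbSU hs (planeRotation z θ)
  let Y : ℝ → SU n := fun θ => (g * k θ) * t * (g * k θ)⁻¹
  have hY : Continuous Y := by
    have h1 : Continuous fun θ => g * k θ :=
      continuous_const.mul ((continuous_coordEmbSU hs).comp (continuous_planeRotation z))
    exact (h1.mul continuous_const).mul ((SU.continuous_inv n).comp h1)
  have hd : ∀ θ, (ψ (Y θ)).IsDiag := fun θ =>
    isDiag_of_reorders_of_coordEmb hn hcomm hg hs (planeRotation z θ) ht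
  have hmem : ∀ i θ, ψ (Y θ) i i ∈ spectrum ℂ (t : Mat n) := by
    intro i θ
    have h1 : spectrum ℂ (Y θ : Mat n) = spectrum ℂ (t : Mat n) := by
      ext c
      rw [Matrix.mem_spectrum_iff_isRoot_charpoly, Matrix.mem_spectrum_iff_isRoot_charpoly,
        charpoly_conj]
    rw [← h1, ← hspec, ← (hd θ).diagonal_diag, spectrum_diagonal]
    exact ⟨i, by simp⟩
  have hconst : ψ (Y θ) = ψ (Y 0) := by
    rw [← (hd θ).diagonal_diag, ← (hd 0).diagonal_diag]
    exact congrArg Matrix.diagonal (funext fun i =>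
      eq_of_continuous_of_mem_finite ((hcont.comp hY).matrix_elem i i)
        (Matrix.finite_spectrum (t : Mat n)) (hmem i) θ 0)
  have h0 : Y 0 = g * t * g⁻¹ := by
    simp only [Y, k, planeRotation_zero, coordEmbSU_one, mul_one]
  change ψ (Y θ) = _
  rw [hconst, h0, hg t ht]

/-- A unitary matrix that conjugates a diagonal matrix with distinct entries to a diagonal matrix
conjugates every diagonal matrix to a diagonal matrix. -/
theorem isDiag_conj_of_isDiag_conj_injective {n : ℕ} (M : SU n) {d : Fin n → ℂ}
    (hd : Function.Injective d)
    (hM : (star (M : Mat n) * Matrix.diagonal d * (M : Mat n)).IsDiag) {L : Mat n} (hL : L.IsDiag) :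
    (star (M : Mat n) * L * (M : Mat n)).IsDiag := by
  set D' := (star (M : Mat n) * Matrix.diagonal d * (M : Mat n)) with hD'
  have h1 : Matrix.diagonal d * (M : Mat n) = (M : Mat n) * D' := by
    rw [hD', ← mul_assoc, ← mul_assoc, SU.mul_star_self, one_mul]
  rw [← hM.diagonal_diag] at h1
  -- With `d` injective, each column of `M` has at most one nonzero entry.
  have h2 : ∀ i j, (M : Mat n) i j ≠ 0 → d i = D'.diag j := by
    intro i j hij
    have h3 := congrFun (congrFun h1 i) j
    rw [Matrix.diagonal_mul, Matrix.mul_diagonal, mul_comm] at h3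
    exact mul_left_cancel₀ hij h3
  intro j k hjk
  have h4 := congrFun (congrFun (SU.star_mul_self M) j) k
  rw [Matrix.one_apply_ne hjk, Matrix.mul_apply] at h4
  rw [← hL.diagonal_diag, mul_assoc, Matrix.mul_apply]
  refine Finset.sum_eq_zero fun i _ => ?_
  rw [Matrix.diagonal_mul, Matrix.star_apply]
  by_cases hj : (M : Mat n) i j = 0
  · simp [hj]
  by_cases hk : (M : Mat n) i k = 0
  · simp [hk]
  -- If columns `j` and `k` met in row `i`, their inner product would be a single nonzero term,
  -- contradicting unitarity.
  rw [Finset.sum_eq_single i (fun i' _ hi' => ?_) (by simp), Matrix.star_apply] at h4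
  · exact absurd h4 (mul_ne_zero (star_ne_zero.2 hj) hk)
  · have : (M : Mat n) i' j = 0 := by
      by_contra hne
      exact hi' (hd ((h2 i' j hne).trans (h2 i j hj).symm))
    simp [this]

/-- The local-to-global principle: for `n ≥ 3`, a reordering on a single conjugate of the diagonal
torus is a reordering everywhere. -/
theorem reorders_of_reorders_conj {n : ℕ} (hn : 3 ≤ n) {ψ : SU n → Mat n}
    (hcont : Continuous ψ) (hspec : SpectrumPreserving ψ)
    (hcomm : CommutativityPreserving ψ) {g : SU n}
    (hg : ∀ t ∈ diagSubgroup n, ψ (g * t * g⁻¹) = Matrix.diagonal (spectralSelection t))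
    (X : SU n) : ψ X = Matrix.diagonal (spectralSelection X) := by
  let S : Set (SU n) :=
    {h | ∀ t ∈ diagSubgroup n, ψ (h * t * h⁻¹) = Matrix.diagonal (spectralSelection t)}
  have hS : IsClosed S := by
    have : S = ⋂ t ∈ diagSubgroup n,
        {h | ψ (h * t * h⁻¹) = Matrix.diagonal (spectralSelection t)} := by
      ext h
      simp [S]
    rw [this]
    refine isClosed_biInter fun t _ => isClosed_eq (hcont.comp ?_) continuous_const
    exact (continuous_id.mul continuous_const).mul (SU.continuous_inv n)
  obtain ⟨u, hu⟩ := exists_conj_mem_diagSubgroup (by omega : 0 < n) (Subgroup.zpowers X)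
    fun Y hY Z hZ => by
      obtain ⟨p, rfl⟩ := Subgroup.mem_zpowers_iff.1 hY
      obtain ⟨q, rfl⟩ := Subgroup.mem_zpowers_iff.1 hZ
      exact (Commute.refl X).zpow_zpow p q
  have hXu := hu X (Subgroup.mem_zpowers X)
  -- `X` may have repeated eigenvalues and is not Hermitian; it is replaced by a Hermitian matrix
  -- with the eigenbasis `u` and simple spectrum. Diagonalizing that matrix diagonalizes `X` too.
  let d : Fin n → ℂ := fun i => (((i : ℕ) : ℝ) : ℂ)
  have hd : Function.Injective d := fun i j hij => Fin.ext (by simpa [d] using hij)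
  have hY : ((u : Mat n) * Matrix.diagonal d * star (u : Mat n)).IsHermitian := by
    refine Matrix.isHermitian_mul_mul_conjTranspose _ ?_
    rw [Matrix.IsHermitian, Matrix.diagonal_conjTranspose]
    congr 1
    ext i
    simp [d]
  obtain ⟨h, hh, hdiag⟩ := exists_isDiag_of_planeRotation_invariant hS ⟨g, hg⟩
    (fun h hh s hs z θ => reorders_mul_planeRotation hn hcont hspec hcomm hh hs z θ) hY
  have hdiag' : (star ((u⁻¹ * h : SU n) : Mat n) * Matrix.diagonal d
      * ((u⁻¹ * h : SU n) : Mat n)).IsDiag := by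
    have h1 : ((u⁻¹ * h : SU n) : Mat n) = star (u : Mat n) * (h : Mat n) := rfl
    rw [h1, star_mul, star_star]
    simpa only [mul_assoc] using hdiag
  have hX : h⁻¹ * X * h ∈ diagSubgroup n := by
    have h1 := isDiag_conj_of_isDiag_conj_injective (u⁻¹ * h) hd hdiag' hXu
    have h2 : h⁻¹ * X * h = (u⁻¹ * h)⁻¹ * (u⁻¹ * X * u) * (u⁻¹ * h) := by group
    rw [h2]
    exact h1
  have h3 := hh _ hX
  have h4 : h * (h⁻¹ * X * h) * h⁻¹ = X := by group
  rw [h4] at h3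
  rw [h3, ← spectralSelection_conj h (h⁻¹ * X * h), h4]

theorem conjBy_inv_conjBy {n : ℕ} (T : GL (Fin n) ℂ) (A : Mat n) :
    conjBy T⁻¹ (conjBy T A) = A := by
  simp [conjBy, mul_assoc]

theorem conjBy_conjBy_inv {n : ℕ} (T : GL (Fin n) ℂ) (A : Mat n) :
    conjBy T (conjBy T⁻¹ A) = A := by
  simpa using conjBy_inv_conjBy T⁻¹ A

theorem conjBy_mul {n : ℕ} (T : GL (Fin n) ℂ) (A B : Mat n) :
    conjBy T (A * B) = conjBy T A * conjBy T B := by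
  simp [conjBy, mul_assoc]

theorem continuous_conjBy {n : ℕ} (T : GL (Fin n) ℂ) : Continuous (conjBy T) :=
  (continuous_const.matrix_mul continuous_id).matrix_mul continuous_const

theorem isSelectionType_of_reordersOn {n : ℕ} (hn : 3 ≤ n) {φ : SU n → Mat n}
    (hcont : Continuous φ) (hspec : SpectrumPreserving φ) (hcomm : CommutativityPreserving φ)
    {H : Subgroup (SU n)} (hH : IsMaximalTorus H) (hφ : ReordersOn φ H) : IsSelectionType φ := by
  obtain ⟨T, hT⟩ := hφ
  obtain ⟨g, hg⟩ := hH.exists_conj_mem (by omega)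
  refine ⟨T, fun X => ?_⟩
  rw [← reorders_of_reorders_conj hn (ψ := fun X => conjBy T⁻¹ (φ X)) ?_ ?_ ?_ (g := g) ?_ X,
    conjBy_conjBy_inv]
  · exact (continuous_conjBy _).comp hcont
  · intro X
    exact (spectrum.units_conjugate (a := φ X) (u := T⁻¹)).trans (hspec X)
  · intro X Y hXY
    simp only [← conjBy_mul, hcomm X Y hXY]
  · intro t ht
    simp only [hT _ (hg t ht), conjBy_inv_conjBy, spectralSelection_conj]

/-! ### The counterexample on SU(2). -/

/-- Determinant one makes the adjugate the inverse, which is the adjoint. -/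
theorem SU_two_entries (X : SU 2) :
    (X : Mat 2) 1 1 = star ((X : Mat 2) 0 0) ∧ (X : Mat 2) 1 0 = -star ((X : Mat 2) 0 1) := by
  have h1 : star (X : Mat 2) = (X : Mat 2).adjugate := by
    have h2 := Matrix.mul_adjugate (X : Mat 2)
    rw [(Matrix.mem_specialUnitaryGroup_iff.1 X.2).2, one_smul] at h2
    calc star (X : Mat 2) = star (X : Mat 2) * ((X : Mat 2) * (X : Mat 2).adjugate) := by
          rw [h2, mul_one]
      _ = _ := by rw [← mul_assoc, SU.star_mul_self, one_mul]
  rw [Matrix.adjugate_fin_two] at h1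
  have h00 := congrFun (congrFun h1 0) 0
  have h10 := congrFun (congrFun h1 1) 0
  simp only [Matrix.star_apply, Matrix.of_apply, Matrix.cons_val', Matrix.cons_val_zero,
    Matrix.cons_val_one, Matrix.cons_val_fin_one] at h00 h10
  exact ⟨h00.symm, by rw [h10, neg_neg]⟩

theorem SU_two_normSq (X : SU 2) :
    ((X : Mat 2) 0 0).re ^ 2 + ((X : Mat 2) 0 0).im ^ 2 + ‖(X : Mat 2) 0 1‖ ^ 2 = 1 := by
  have h := (Matrix.mem_specialUnitaryGroup_iff.1 X.2).2
  obtain ⟨h1, h2⟩ := SU_two_entries X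
  rw [Matrix.det_fin_two, h1, h2, mul_neg, sub_neg_eq_add, RCLike.star_def,
    Complex.mul_conj, Complex.mul_conj, ← Complex.ofReal_add] at h
  have h3 : Complex.normSq ((X : Mat 2) 0 0) + Complex.normSq ((X : Mat 2) 0 1) = 1 := by
    exact_mod_cast h
  rw [Complex.sq_norm, ← h3, Complex.normSq_apply ((X : Mat 2) 0 0)]
  ring

/-- The sine of the rotation angle of an element of `SU(2)`. -/
noncomputable def angleSin (X : SU 2) : ℝ := Real.sqrt (1 - ((X : Mat 2) 0 0).re ^ 2)

theorem angleSin_nonneg (X : SU 2) : 0 ≤ angleSin X := Real.sqrt_nonneg _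

theorem angleSin_sq (X : SU 2) :
    angleSin X ^ 2 = ((X : Mat 2) 0 0).im ^ 2 + ‖(X : Mat 2) 0 1‖ ^ 2 := by
  have h := SU_two_normSq X
  rw [angleSin, Real.sq_sqrt]
  · linarith
  · nlinarith [sq_nonneg ((X : Mat 2) 0 0).im, sq_nonneg ‖(X : Mat 2) 0 1‖]

theorem angleSin_sq_eq_one_sub (X : SU 2) :
    angleSin X ^ 2 = 1 - ((X : Mat 2) 0 0).re ^ 2 := by
  linarith [SU_two_normSq X, angleSin_sq X]

theorem SU_two_trace (X : SU 2) : (X : Mat 2).trace = 2 * (((X : Mat 2) 0 0).re : ℂ) := by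
  rw [Matrix.trace_fin_two, (SU_two_entries X).1, RCLike.star_def, Complex.add_conj]
  push_cast
  ring

/-- The angles are `-x` and `x` with `0 ≤ x ≤ 1/2`; the trace gives the cosine of `2πx`, and the
range makes the sine the nonnegative root. -/
theorem spectralSelection_SU_two (X : SU 2) :
    spectralSelection X 0 = (((X : Mat 2) 0 0).re : ℂ) - angleSin X * Complex.I ∧
    spectralSelection X 1 = (((X : Mat 2) 0 0).re : ℂ) + angleSin X * Complex.I := by
  have hx := spectralAngles_spec X
  set x := spectralAngles X with hxd
  have hs : x 0 = -x 1 := by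
    have := hx.sum_eq_zero
    rw [Fin.sum_univ_two] at this
    linarith
  have hm := hx.mono (Fin.zero_le 1)
  have hw := hx.width 0 1
  have e1 : spectralSelection X 1 = (Real.cos (2 * Real.pi * x 1) : ℂ)
      + (Real.sin (2 * Real.pi * x 1) : ℂ) * Complex.I := by
    have : 2 * Real.pi * Complex.I * (x 1 : ℂ) = ((2 * Real.pi * x 1 : ℝ) : ℂ) * Complex.I := by
      push_cast; ring
    rw [spectralSelection, ← hxd, this, Complex.exp_mul_I, Complex.ofReal_cos, Complex.ofReal_sin]
  have e0 : spectralSelection X 0 = (Real.cos (2 * Real.pi * x 1) : ℂ)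
      - (Real.sin (2 * Real.pi * x 1) : ℂ) * Complex.I := by
    have : 2 * Real.pi * Complex.I * (x 0 : ℂ) = ((-(2 * Real.pi * x 1) : ℝ) : ℂ) * Complex.I := by
      rw [hs]; push_cast; ring
    rw [spectralSelection, ← hxd, this, Complex.exp_mul_I, ← Complex.ofReal_cos,
      ← Complex.ofReal_sin, Real.cos_neg, Real.sin_neg]
    push_cast
    ring
  have hc : Real.cos (2 * Real.pi * x 1) = ((X : Mat 2) 0 0).re := by
    have h1 := Matrix.trace_eq_sum_roots_charpoly (X : Mat 2)
    have h2 : (Finset.univ.val.map fun j =>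
        Complex.exp (2 * Real.pi * Complex.I * (x j : ℂ))).sum
        = spectralSelection X 0 + spectralSelection X 1 := by
      change ∑ j, spectralSelection X j = _
      rw [Fin.sum_univ_two]
    rw [hx.spec, h2, SU_two_trace, e0, e1] at h1
    have h3 : (Real.cos (2 * Real.pi * x 1) : ℂ) = (((X : Mat 2) 0 0).re : ℂ) := by
      linear_combination -h1 / 2
    exact_mod_cast h3
  have hsin : Real.sin (2 * Real.pi * x 1) = angleSin X := by
    rw [angleSin, ← hc, ← Real.sin_sq, Real.sqrt_sq]
    have hpi := Real.pi_pos
    apply Real.sin_nonneg_of_nonneg_of_le_pi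
    · have : 0 ≤ x 1 := by linarith
      positivity
    · have : x 1 ≤ 1 / 2 := by linarith
      nlinarith
  rw [e0, e1, hc, hsin]
  exact ⟨rfl, rfl⟩

/-- Commuting elements of `SU(2)` have proportional traceless parts. -/
theorem norm_mul_angleSin_comm {X Y : SU 2} (h : X * Y = Y * X) :
    ‖(X : Mat 2) 0 1‖ * angleSin Y = ‖(Y : Mat 2) 0 1‖ * angleSin X := by
  have h1 : (X : Mat 2) * (Y : Mat 2) = (Y : Mat 2) * (X : Mat 2) := congrArg Subtype.val h
  have h2 := congrFun (congrFun h1 0) 1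
  rw [Matrix.mul_apply, Matrix.mul_apply, Fin.sum_univ_two, Fin.sum_univ_two,
    (SU_two_entries X).1, (SU_two_entries Y).1] at h2
  have hX := Complex.sub_conj ((X : Mat 2) 0 0)
  have hY := Complex.sub_conj ((Y : Mat 2) 0 0)
  simp only [RCLike.star_def] at h2
  -- This is the upper right entry of `XY = YX`, using `a - conj a = 2i Im a`.
  have h3 : (((X : Mat 2) 0 0).im : ℂ) * (Y : Mat 2) 0 1
      = (((Y : Mat 2) 0 0).im : ℂ) * (X : Mat 2) 0 1 := by
    have h4 : (2 * Complex.I) * ((((X : Mat 2) 0 0).im : ℂ) * (Y : Mat 2) 0 1)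
      = (2 * Complex.I) * ((((Y : Mat 2) 0 0).im : ℂ) * (X : Mat 2) 0 1) := by
      push_cast at hX hY
      linear_combination h2 - (Y : Mat 2) 0 1 * hX + (X : Mat 2) 0 1 * hY
    exact mul_left_cancel₀ (by simp) h4
  have h5 : ((X : Mat 2) 0 0).im ^ 2 * ‖(Y : Mat 2) 0 1‖ ^ 2
      = ((Y : Mat 2) 0 0).im ^ 2 * ‖(X : Mat 2) 0 1‖ ^ 2 := by
    have := congrArg (fun w : ℂ => ‖w‖ ^ 2) h3
    simpa [mul_pow] using this
  rw [← sq_eq_sq₀ (mul_nonneg (norm_nonneg _) (angleSin_nonneg _))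
    (mul_nonneg (norm_nonneg _) (angleSin_nonneg _)), mul_pow, mul_pow, angleSin_sq, angleSin_sq]
  linear_combination -h5

/-- A map on `SU(2)` that reorders on every maximal torus, but not globally. -/
noncomputable def toralReordering (X : SU 2) : Mat 2 :=
  !![(((X : Mat 2) 0 0).re : ℂ) - angleSin X * Complex.I, (‖(X : Mat 2) 0 1‖ : ℂ);
    0, (((X : Mat 2) 0 0).re : ℂ) + angleSin X * Complex.I]

theorem continuous_toralReordering : Continuous toralReordering := by
  have h : ∀ i j, Continuous fun X : SU 2 => (X : Mat 2) i j :=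
    fun i j => continuous_subtype_val.matrix_elem i j
  have hre : Continuous fun X : SU 2 => ((X : Mat 2) 0 0).re := Complex.continuous_re.comp (h 0 0)
  have hs : Continuous angleSin := (continuous_const.sub (hre.pow 2)).sqrt
  have hn : Continuous fun X : SU 2 => ‖(X : Mat 2) 0 1‖ := (h 0 1).norm
  refine continuous_matrix fun i j => ?_
  fin_cases i <;> fin_cases j <;> simp [toralReordering] <;> fun_prop

theorem spectrumPreserving_toralReordering : SpectrumPreserving toralReordering := by
  intro X
  have h : (toralReordering X).charpoly = (X : Mat 2).charpoly := by
    rw [Matrix.charpoly_fin_two, Matrix.charpoly_fin_two]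
    have ht : (toralReordering X).trace = (X : Mat 2).trace := by
      rw [SU_two_trace, toralReordering, Matrix.trace_fin_two_of]
      ring
    have hd : (toralReordering X).det = (X : Mat 2).det := by
      rw [(Matrix.mem_specialUnitaryGroup_iff.1 X.2).2, toralReordering, Matrix.det_fin_two_of]
      have h1 : (angleSin X : ℂ) ^ 2 = 1 - (((X : Mat 2) 0 0).re : ℂ) ^ 2 := by
        exact_mod_cast angleSin_sq_eq_one_sub X
      linear_combination h1 - (angleSin X : ℂ) ^ 2 * Complex.I_sq
    rw [ht, hd]
  ext c
  rw [Matrix.mem_spectrum_iff_isRoot_charpoly, Matrix.mem_spectrum_iff_isRoot_charpoly, h]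

/-- For upper triangular matrices only the corner of the commutator matters, and here it is `2i
(|X₀₁| s_Y - |Y₀₁| s_X)` with `s` the sine. -/
theorem commutativityPreserving_toralReordering : CommutativityPreserving toralReordering := by
  intro X Y hXY
  have h : (‖(X : Mat 2) 0 1‖ : ℂ) * angleSin Y = (‖(Y : Mat 2) 0 1‖ : ℂ) * angleSin X := by
    exact_mod_cast norm_mul_angleSin_comm hXY
  rw [toralReordering, toralReordering, Matrix.mul_fin_two, Matrix.mul_fin_two]
  ext i j
  fin_cases i <;> fin_cases j <;> simp
  · ring
  · linear_combination 2 * Complex.I * h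
  · ring

theorem reordersOn_toralReordering {H : Subgroup (SU 2)}
    (hH : ∀ X ∈ H, ∀ Y ∈ H, X * Y = Y * X) : ReordersOn toralReordering H := by
  -- Any non-central element of `H` determines the ratio; if all sines vanish, so do the
  -- off-diagonal entries.
  obtain ⟨κ, hκ⟩ : ∃ κ : ℝ, ∀ Y ∈ H, ‖(Y : Mat 2) 0 1‖ = κ * angleSin Y := by
    by_cases h : ∃ X ∈ H, angleSin X ≠ 0
    · obtain ⟨X, hX, hX0⟩ := h
      refine ⟨‖(X : Mat 2) 0 1‖ / angleSin X, fun Y hY => ?_⟩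
      rw [div_mul_eq_mul_div, eq_div_iff hX0]
      exact (norm_mul_angleSin_comm (hH X hX Y hY)).symm
    · push Not at h
      refine ⟨0, fun Y hY => ?_⟩
      have h1 := angleSin_sq Y
      rw [h Y hY] at h1
      have h2 : ‖(Y : Mat 2) 0 1‖ ^ 2 = 0 := by
        nlinarith [sq_nonneg ((Y : Mat 2) 0 0).im, sq_nonneg ‖(Y : Mat 2) 0 1‖]
      rw [zero_mul]
      exact pow_eq_zero_iff two_ne_zero |>.1 h2
  -- The unipotent conjugation creates the corner `τ (λ₂ - λ₁) = 2iτ s`, which has to equal `κ s`.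
  let τ : ℂ := -(κ / 2) * Complex.I
  have hU : !![1, τ; 0, 1] * !![1, -τ; 0, 1] = (1 : Mat 2) := by
    rw [Matrix.mul_fin_two, Matrix.one_fin_two]; simp
  have hV : !![1, -τ; 0, 1] * !![1, τ; 0, 1] = (1 : Mat 2) := by
    rw [Matrix.mul_fin_two, Matrix.one_fin_two]; simp
  refine ⟨⟨!![1, τ; 0, 1], !![1, -τ; 0, 1], hU, hV⟩, fun X hX => ?_⟩
  change toralReordering X = !![1, τ; 0, 1] * Matrix.diagonal (spectralSelection X)
    * !![1, -τ; 0, 1]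
  have hd : Matrix.diagonal (spectralSelection X)
      = !![spectralSelection X 0, 0; 0, spectralSelection X 1] := by
    rw [Matrix.eta_fin_two (Matrix.diagonal _)]
    simp
  rw [hd, (spectralSelection_SU_two X).1, (spectralSelection_SU_two X).2, toralReordering, hκ X hX,
    Matrix.mul_fin_two, Matrix.mul_fin_two]
  ext i j
  fin_cases i <;> fin_cases j <;> simp
  simp only [τ]
  linear_combination κ * (angleSin X : ℂ) * Complex.I_sq

theorem not_isSelectionType_toralReordering : ¬ IsSelectionType toralReordering := by
  rintro ⟨T, hT⟩
  -- Both matrices have trace zero, hence the same selection, but their off-diagonal moduli are `1`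
  -- and `0`.
  let X : SU 2 := planeRotation 1 (Real.pi / 2)
  let D : SU 2 := ⟨!![Complex.I, 0; 0, -Complex.I], by
    rw [Matrix.mem_specialUnitaryGroup_iff, Matrix.mem_unitaryGroup_iff]
    constructor
    · ext i j
      fin_cases i <;> fin_cases j <;> simp [Matrix.mul_apply, Fin.sum_univ_two]
    · simp [Matrix.det_fin_two]⟩
  have hX0 : (X : Mat 2) 0 0 = 0 := by simp [X, planeRotation]
  have hX1 : (X : Mat 2) 0 1 = -1 := by simp [X, planeRotation]
  have hD0 : ((D : Mat 2) 0 0).re = 0 := by simp [D]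
  have hD1 : (D : Mat 2) 0 1 = 0 := by simp [D]
  have hsin : angleSin X = angleSin D := by rw [angleSin, angleSin, hX0, hD0, Complex.zero_re]
  have hsel : spectralSelection X = spectralSelection D := by
    ext i
    fin_cases i
    · exact (spectralSelection_SU_two X).1.trans (by
        rw [hX0, hsin, Complex.zero_re, ← hD0]; exact (spectralSelection_SU_two D).1.symm)
    · exact (spectralSelection_SU_two X).2.trans (by
        rw [hX0, hsin, Complex.zero_re, ← hD0]; exact (spectralSelection_SU_two D).2.symm)
  have h : toralReordering X = toralReordering D := by rw [hT, hT, hsel]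
  have h01 := congrFun (congrFun h 0) 1
  simp [toralReordering, hX1, hD1] at h01

theorem proposition1p13 :
    (∀ (n : ℕ), 3 ≤ n → ∀ φ : SU n → Mat n,
      Continuous φ → SpectrumPreserving φ → CommutativityPreserving φ →
      (∃ H : Subgroup (SU n), IsMaximalTorus H ∧ ReordersOn φ H) →
      IsSelectionType φ) ∧
    (∃ φ : SU 2 → Mat 2,
      Continuous φ ∧ SpectrumPreserving φ ∧ CommutativityPreserving φ ∧
      (∃ H : Subgroup (SU 2), IsMaximalTorus H) ∧
      (∀ H : Subgroup (SU 2), IsMaximalTorus H → ReordersOn φ H) ∧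
      ¬ IsSelectionType φ) :=
  ⟨fun _ hn _ hcont hspec hcomm ⟨_, hH, hφ⟩ =>
      isSelectionType_of_reordersOn hn hcont hspec hcomm hH hφ,
    toralReordering, continuous_toralReordering, spectrumPreserving_toralReordering,
    commutativityPreserving_toralReordering, ⟨_, isMaximalTorus_diagSubgroup_two⟩,
    fun _ hH => reordersOn_toralReordering fun _ hX _ hY => hH.1.comm hX hY,
    not_isSelectionType_toralReordering⟩
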